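/- Let $D\ge 0$ be an even integer and let $Q_D$ be the hypercube with vertex set $\mathcal X=\{0,1\}^D$, two vertices being adjacent when they differ in exactly one coordinate; let $\partial$ be its path-length distance. Fix a vertex $\mathbf x\in\mathcal X$ and let $V=\mathbb C^{\mathcal X}$ be the standard module. Let $\mathbf A$ be the adjacency matrix of $Q_D$, and for $0\le i\le D$ let $\mathbf E^*_i$ be the diagonal matrix whose $(\mathbf y,\mathbf y)$-entry is $1$ if $\partial(\mathbf x,\mathbf y)=i$ and $0$ otherwise. Let $T=T(\mathbf x)$ be the Terwilliger algebra, i.e. the subalgebra of $\mathrm{Mat}_{\mathcal X}(\mathbb C)$ generated by $\mathbf A,\mathbf E^*_0,\dots,\mathbf E^*_D$. A $T$-module is a subspace $W\subseteq V$ with $TW\subseteq W$; it is irreducible if $W\neq0$ and its only $T$-submodules are $0$ and $W$; its endpoint is $\min\{i:\mathbf E^*_iW\ne0\}$. For an ordering $\theta_0,\dots,\theta_D$ of the eigenvalues of $\mathbf A$, the primitive idempotents are $\mathbf E_i=\prod_{j\ne i}(\mathbf A-\theta_j\mathbf I)/(\theta_i-\theta_j)$ for $0\le i\le D$ (and $\mathbf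 E_i=0$ for $i<0$ or $i>D$), and the $i$-th dual distance matrix is the diagonal matrix with $(\mathbf y,\mathbf y)$-entry $|\mathcal X|(\mathbf E_i)_{\mathbf x\mathbf y}$. Let $\mathbf A^*_i$ be the $i$-th dual distance matrix for the ordering $\theta_i=D-2i$, and let $\mathbf B$ be the first dual distance matrix (the dual adjacency matrix) for the ordering $\theta_i=(-1)^i(D-2i)$. Let $\mathcal A$ be the anticommutator spin algebra, i.e. the unital associative $\mathbb C$-algebra with generators $x,y,z$ and relations $xy+yx=2z$, $yz+zy=2x$, $zx+xz=2y$. There is a unique $\mathcal A$-module structure on $V$ in which $x,y$ act as $\mathbf A,\mathbf A^*_{D-1}$ respectively; let $\mathbf C$ be the matrix representing $z$ in it. **Theorem.** Let $W$ be an irreducible $T$-module with endpoint $r$. Then $W$ is invariant under $\mathbf A,\mathbf B,\mathbf C$, and the actions $A,A^*,A^\varepsilon$ of $\mathbf A,\mathbf B,\mathbf C$ on $W$ form a totally bipartite Leonard triple of Bannai/Ito type which is normalized, that is, $$AA^*+A^*A=2A^\varepsilon,\qquad A^*A^\varepsilon+A^\varepsilon A^*=2A,\qquad A^\varepsilon A+AA^\varepsilon=2A^*,$$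 and which has diameter $\dim W-1=D-2r$. Here a Leonard triple on a space $W$ of finite positive dimension $d+1$ is an ordered triple of endomorphisms such that, for each of them, there is a basis of $W$ in which its matrix is diagonal and the matrices of the other two are irreducible tridiagonal (tridiagonal with all sub- and superdiagonal entries nonzero). It is totally bipartite if all six tridiagonal matrices have zero diagonal (in every such basis). It is of Bannai/Ito type if, for every basis in which $A$ is diagonal with successive diagonal entries $\theta_0,\dots,\theta_d$ and $A^*,A^\varepsilon$ are irreducible tridiagonal, $(\theta_{i-2}-\theta_{i+1})/(\theta_{i-1}-\theta_i)=-1$ for $2\le i\le d-1$. -/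

import Mathlib

section LeonardTriples

/-- A square matrix is tridiagonal when every nonzero entry lies on the diagonal, the subdiagonal
or the superdiagonal. -/
def IsTridiagonal {K : Type*} [Field K] {n : ℕ} (M : Matrix (Fin n) (Fin n) K) : Prop :=
  ∀ i j : Fin n, M i j ≠ 0 → (i : ℕ) ≤ (j : ℕ) + 1 ∧ (j : ℕ) ≤ (i : ℕ) + 1

/-- A tridiagonal matrix is irreducible when every entry on the subdiagonal and on the
superdiagonal is nonzero. -/
def IsIrreducibleTridiagonal {K : Type*} [Field K] {n : ℕ}
    (M : Matrix (Fin n) (Fin n) K) : Prop :=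
  IsTridiagonal M ∧ ∀ i j : Fin n, (i : ℕ) + 1 = (j : ℕ) → M i j ≠ 0 ∧ M j i ≠ 0

/-- A tridiagonal matrix is bipartite when all its diagonal entries vanish. -/
def IsBipartiteMatrix {K : Type*} [Field K] {d : ℕ}
    (M : Matrix (Fin (d + 1)) (Fin (d + 1)) K) : Prop :=
  IsTridiagonal M ∧ ∀ i, M i i = 0

/-- A tridiagonal matrix with rows and columns indexed by `0, …, d` is almost bipartite when exactly
one of its two extreme diagonal entries (the same one if `d = 0`) is nonzero and all other diagonal
entries vanish. -/
def IsAlmostBipartiteMatrix {K : Type*} [Field K] {d : ℕ}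
    (M : Matrix (Fin (d + 1)) (Fin (d + 1)) K) : Prop :=
  IsTridiagonal M ∧ (∃! i, (i = 0 ∨ i = Fin.last d) ∧ M i i ≠ 0) ∧
    ∀ i, i ≠ 0 → i ≠ Fin.last d → M i i = 0

/-- The basis `b` makes `A` diagonal and `A'`, `A''` irreducible tridiagonal. -/
def IsStandardBasis {K V : Type*} [Field K] [AddCommGroup V] [Module K V] {d : ℕ}
    (b : Module.Basis (Fin (d + 1)) K V) (A A' A'' : Module.End K V) : Prop :=
  (LinearMap.toMatrix b b A).IsDiag ∧
    IsIrreducibleTridiagonal (LinearMap.toMatrix b b A') ∧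
    IsIrreducibleTridiagonal (LinearMap.toMatrix b b A'')

/-- Leonard triples. The bases are indexed by `0, …, d` for some natural number `d`, so the
underlying space has finite positive dimension. -/
structure IsLeonardTriple {K V : Type*} [Field K] [AddCommGroup V] [Module K V]
    (A A' A'' : Module.End K V) : Prop where
  first : ∃ (d : ℕ) (b : Module.Basis (Fin (d + 1)) K V), IsStandardBasis b A A' A''
  second : ∃ (d : ℕ) (b : Module.Basis (Fin (d + 1)) K V), IsStandardBasis b A' A'' A
  third : ∃ (d : ℕ) (b : Module.Basis (Fin (d + 1)) K V), IsStandardBasis b A'' A A'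

/-- The diameter of a Leonard triple on `V` is one less than the dimension of `V`. -/
noncomputable def leonardDiameter (K V : Type*) [Field K] [AddCommGroup V] [Module K V] : ℤ :=
  (Module.finrank K V : ℤ) - 1

/-- A Leonard triple is totally bipartite when each of the six tridiagonal matrices occurring in the
definition of a Leonard triple is bipartite. -/
structure IsTotallyBipartite {K V : Type*} [Field K] [AddCommGroup V] [Module K V]
    (A A' A'' : Module.End K V) : Prop extends IsLeonardTriple A A' A'' where
  bip_first : ∀ (d : ℕ) (b : Module.Basis (Fin (d + 1)) K V), IsStandardBasis b A A' A'' →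
    IsBipartiteMatrix (LinearMap.toMatrix b b A') ∧ IsBipartiteMatrix (LinearMap.toMatrix b b A'')
  bip_second : ∀ (d : ℕ) (b : Module.Basis (Fin (d + 1)) K V), IsStandardBasis b A' A'' A →
    IsBipartiteMatrix (LinearMap.toMatrix b b A'') ∧ IsBipartiteMatrix (LinearMap.toMatrix b b A)
  bip_third : ∀ (d : ℕ) (b : Module.Basis (Fin (d + 1)) K V), IsStandardBasis b A'' A A' →
    IsBipartiteMatrix (LinearMap.toMatrix b b A) ∧ IsBipartiteMatrix (LinearMap.toMatrix b b A')

/-- A Leonard triple is totally almost bipartite when each of the six tridiagonal matrices occurring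
in the definition of a Leonard triple is almost bipartite. -/
structure IsTotallyAlmostBipartite {K V : Type*} [Field K] [AddCommGroup V] [Module K V]
    (A A' A'' : Module.End K V) : Prop extends IsLeonardTriple A A' A'' where
  abip_first : ∀ (d : ℕ) (b : Module.Basis (Fin (d + 1)) K V), IsStandardBasis b A A' A'' →
    IsAlmostBipartiteMatrix (LinearMap.toMatrix b b A') ∧
      IsAlmostBipartiteMatrix (LinearMap.toMatrix b b A'')
  abip_second : ∀ (d : ℕ) (b : Module.Basis (Fin (d + 1)) K V), IsStandardBasis b A' A'' A →
    IsAlmostBipartiteMatrix (LinearMap.toMatrix b b A'') ∧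
      IsAlmostBipartiteMatrix (LinearMap.toMatrix b b A)
  abip_third : ∀ (d : ℕ) (b : Module.Basis (Fin (d + 1)) K V), IsStandardBasis b A'' A A' →
    IsAlmostBipartiteMatrix (LinearMap.toMatrix b b A) ∧
      IsAlmostBipartiteMatrix (LinearMap.toMatrix b b A')

/-- A Leonard triple `A, A', A''` is of Bannai/Ito type when, for each standard basis, the
corresponding eigenvalues `θ 0, …, θ d` of `A` satisfy
`(θ (i-2) - θ (i+1)) / (θ (i-1) - θ i) = -1` for `2 ≤ i ≤ d - 1`. -/
structure IsBannaiIto {K V : Type*} [Field K] [AddCommGroup V] [Module K V]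
    (A A' A'' : Module.End K V) : Prop extends IsLeonardTriple A A' A'' where
  ratio : ∀ (d : ℕ) (b : Module.Basis (Fin (d + 1)) K V), IsStandardBasis b A A' A'' →
    ∀ θ : Fin (d + 1) → K, (∀ i, A (b i) = θ i • b i) →
      ∀ (i : ℕ) (h2 : 2 ≤ i) (hd : i + 1 ≤ d),
        (θ ⟨i - 2, by omega⟩ - θ ⟨i + 1, by omega⟩) /
          (θ ⟨i - 1, by omega⟩ - θ ⟨i, by omega⟩) = -1

/-- The relations attaching scalars `ν`, `ν'`, `ν''` to the triple `A`, `A'`, `A''`. -/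
def SatisfiesAnticommutators {K V : Type*} [Field K] [AddCommGroup V] [Module K V]
    (A A' A'' : Module.End K V) (ν ν' ν'' : K) : Prop :=
  A * A' + A' * A = ν'' • A'' ∧ A' * A'' + A'' * A' = ν • A ∧ A'' * A + A * A'' = ν' • A'

/-- A normalized Leonard triple: a Leonard triple of Bannai/Ito type, totally bipartite or totally
almost bipartite, whose scalars `ν`, `ν'`, `ν''` are all equal to `2`. -/
structure IsNormalizedLeonardTriple {K V : Type*} [Field K] [AddCommGroup V] [Module K V]
    (A A' A'' : Module.End K V) : Prop where
  total : IsTotallyBipartite A A' A'' ∨ IsTotallyAlmostBipartite A A' A''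
  bannaiIto : IsBannaiIto A A' A''
  scalars : SatisfiesAnticommutators A A' A'' 2 2 2

end LeonardTriples

section SpinAlgebra

/-- The three generators of the anticommutator spin algebra. -/
inductive SpinGen : Type
  | x
  | y
  | z

/-- The defining relations `xy + yx = 2z`, `yz + zy = 2x`, `zx + xz = 2y`. -/
inductive SpinRel (K : Type*) [Field K] : FreeAlgebra K SpinGen → FreeAlgebra K SpinGen → Prop
  | xy : SpinRel K
      (FreeAlgebra.ι K SpinGen.x * FreeAlgebra.ι K SpinGen.y +
        FreeAlgebra.ι K SpinGen.y * FreeAlgebra.ι K SpinGen.x)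
      (2 * FreeAlgebra.ι K SpinGen.z)
  | yz : SpinRel K
      (FreeAlgebra.ι K SpinGen.y * FreeAlgebra.ι K SpinGen.z +
        FreeAlgebra.ι K SpinGen.z * FreeAlgebra.ι K SpinGen.y)
      (2 * FreeAlgebra.ι K SpinGen.x)
  | zx : SpinRel K
      (FreeAlgebra.ι K SpinGen.z * FreeAlgebra.ι K SpinGen.x +
        FreeAlgebra.ι K SpinGen.x * FreeAlgebra.ι K SpinGen.z)
      (2 * FreeAlgebra.ι K SpinGen.y)

/-- The anticommutator spin algebra over `K`. -/
abbrev SpinAlgebra (K : Type*) [Field K] : Type _ := RingQuot (SpinRel K)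

/-- The image of a generator in the anticommutator spin algebra. -/
noncomputable def SpinAlgebra.gen (K : Type*) [Field K] (g : SpinGen) : SpinAlgebra K :=
  RingQuot.mkAlgHom K (SpinRel K) (FreeAlgebra.ι K g)

end SpinAlgebra

section Graphs

/-- The `i`-th distance matrix of a connected graph. -/
noncomputable def distanceMatrix {X : Type*} (Γ : SimpleGraph X) (i : ℕ) : Matrix X X ℂ :=
  Matrix.of fun y z => if Γ.dist y z = i then 1 else 0

/-- The `i`-th dual idempotent with regard to the vertex `x`. -/
noncomputable def dualIdempotent {X : Type*} [DecidableEq X] (Γ : SimpleGraph X) (x : X) (i : ℕ) :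
    Matrix X X ℂ :=
  Matrix.diagonal fun y => if Γ.dist x y = i then 1 else 0

/-- The Bose-Mesner algebra: the algebra generated by the adjacency matrix. -/
noncomputable def boseMesner {X : Type*} [Fintype X] [DecidableEq X] (Γ : SimpleGraph X) :
    Subalgebra ℂ (Matrix X X ℂ) :=
  Algebra.adjoin ℂ {distanceMatrix Γ 1}

/-- The dual Bose-Mesner algebra with regard to `x`. The dual idempotents are mutually orthogonal
idempotents with sum `1`, so that the algebra that they generate is their linear span. -/
noncomputable def dualBoseMesner {X : Type*} [Fintype X] [DecidableEq X] (Γ : SimpleGraph X) (x : X) :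
    Subalgebra ℂ (Matrix X X ℂ) :=
  Algebra.adjoin ℂ (Set.range (dualIdempotent Γ x))

/-- The Terwilliger algebra with regard to `x`. -/
noncomputable def terwilligerAlgebra {X : Type*} [Fintype X] [DecidableEq X] (Γ : SimpleGraph X) (x : X) :
    Subalgebra ℂ (Matrix X X ℂ) :=
  boseMesner Γ ⊔ dualBoseMesner Γ x

/-- A module for the Terwilliger algebra: a subspace of the standard module `ℂ^X` that the algebra
leaves invariant. -/
def IsTModule {X : Type*} [Fintype X] [DecidableEq X] (Γ : SimpleGraph X) (x : X)
    (W : Submodule ℂ (X → ℂ)) : Prop :=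
  ∀ N ∈ terwilligerAlgebra Γ x, ∀ w ∈ W, N.mulVec w ∈ W

/-- An irreducible module for the Terwilliger algebra. -/
def IsIrreducibleTModule {X : Type*} [Fintype X] [DecidableEq X] (Γ : SimpleGraph X) (x : X)
    (W : Submodule ℂ (X → ℂ)) : Prop :=
  IsTModule Γ x W ∧ W ≠ ⊥ ∧
    ∀ U : Submodule ℂ (X → ℂ), IsTModule Γ x U → U ≤ W → U = ⊥ ∨ U = W

/-- The natural number `r` is the endpoint of `W`: the least `i` such that the `i`-th dual
idempotent does not annihilate `W`. -/
def IsEndpoint {X : Type*} [Fintype X] [DecidableEq X] (Γ : SimpleGraph X) (x : X)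
    (W : Submodule ℂ (X → ℂ)) (r : ℕ) : Prop :=
  IsLeast {i : ℕ | ∃ w ∈ W, (dualIdempotent Γ x i).mulVec w ≠ 0} r

/-- The primitive idempotent `E i` of a distance-regular graph of diameter `D` with regard to an
ordering `θ 0, …, θ D` of its (distinct) eigenvalues, that is, the product over `j ≠ i` of
`(A - θ j) / (θ i - θ j)`, where `A` is the adjacency matrix. It is `0` unless `0 ≤ i ≤ D`. -/
noncomputable def primitiveIdempotent {X : Type*} [Fintype X] [DecidableEq X] (Γ : SimpleGraph X)
    (D : ℕ) (θ : ℕ → ℂ) (i : ℤ) : Matrix X X ℂ :=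
  if 0 ≤ i ∧ i ≤ D then
    Polynomial.aeval (distanceMatrix Γ 1) (Lagrange.basis (Finset.range (D + 1)) θ i.toNat)
  else 0

/-- The `i`-th dual distance matrix with regard to the vertex `x` and the ordering `θ` of the
eigenvalues: it is diagonal with `(y, y)`-entry `|X|` times the `(x, y)`-entry of `E i`. -/
noncomputable def dualDistanceMatrix {X : Type*} [Fintype X] [DecidableEq X] (Γ : SimpleGraph X)
    (D : ℕ) (θ : ℕ → ℂ) (x : X) (i : ℤ) : Matrix X X ℂ :=
  Matrix.diagonal fun y => (Fintype.card X : ℂ) * primitiveIdempotent Γ D θ i x y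

end Graphs

section Hypercube

/-- The hypercube `Q_D`: vertices are 0/1-sequences of length `D`, adjacent when they differ in
exactly one coordinate. -/
def hypercube (D : ℕ) : SimpleGraph (Fin D → Bool) where
  Adj y z := hammingDist y z = 1
  symm := ⟨fun y z h => by rw [hammingDist_comm]; exact h⟩
  loopless := ⟨fun y h => by simp at h⟩

/-- The adjacency matrix of the hypercube. -/
noncomputable def cubeA (D : ℕ) : Matrix (Fin D → Bool) (Fin D → Bool) ℂ :=
  distanceMatrix (hypercube D) 1

/-- The dual distance matrices `A*_i` of the hypercube, for the ordering `D - 2i` (`0 ≤ i ≤ D`) of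
the eigenvalues. -/
noncomputable def cubeDual (D : ℕ) (x : Fin D → Bool) (i : ℤ) :
    Matrix (Fin D → Bool) (Fin D → Bool) ℂ :=
  dualDistanceMatrix (hypercube D) D (fun j => (D : ℂ) - 2 * j) x i

/-- For even `D`, the dual adjacency matrix `B` of the hypercube for the ordering `(-1)^i (D - 2i)`
(`0 ≤ i ≤ D`) of the eigenvalues. -/
noncomputable def cubeB (D : ℕ) (x : Fin D → Bool) :
    Matrix (Fin D → Bool) (Fin D → Bool) ℂ :=
  dualDistanceMatrix (hypercube D) D (fun j => (-1) ^ j * ((D : ℂ) - 2 * j)) x 1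

/-- A module structure of the anticommutator spin algebra on the standard module of the hypercube is
positive when the generators `x`, `y` act as `A`, `A*_{D-1}`. -/
def IsPositiveStructure (D : ℕ) (x : Fin D → Bool)
    (ρ : SpinAlgebra ℂ →ₐ[ℂ] Module.End ℂ ((Fin D → Bool) → ℂ)) : Prop :=
  ρ (SpinAlgebra.gen ℂ SpinGen.x) = Matrix.toLin' (cubeA D) ∧
    ρ (SpinAlgebra.gen ℂ SpinGen.y) = Matrix.toLin' (cubeDual D x ((D : ℤ) - 1))

open Classical in
/-- The matrix `C` that represents the action of the generator `z` under the positive module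
structure (with a default value if there were no such structure). -/
noncomputable def cubeC (D : ℕ) (x : Fin D → Bool) :
    Matrix (Fin D → Bool) (Fin D → Bool) ℂ :=
  if h : ∃ ρ, IsPositiveStructure D x ρ then
    LinearMap.toMatrix' (h.choose (SpinAlgebra.gen ℂ SpinGen.z))
  else 0

end Hypercube

/-! Write the adjacency matrix as L + R, where L = `lower x` and R = `raise x` move functions one
level towards and away from the base vertex. With H = `weight x`, which is D - 2k at distance k,
they satisfy the sl₂ relations. The sign P = `parity x` anticommutes with L and R, commutes with H
and squares to 1. These identities alone give the spin relations for L + R, PH and RP + PL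
(`spinRelations_of_sl2`), and the squares of these three sum to the sl₂ Casimir element H² + 2H +
4RL (`casimir_of_sl2`). Expansion in characters shows that PH is both A*_{D-1} and B: for D > 0 both
indices select the eigenvalue 2 - D, hence the same primitive idempotent. Since z is determined by x
and y, the matrix C is RP + PL.

If W is irreducible with endpoint r, a nonzero vector of W at level r is killed by L, and its images
under powers of R span a T-submodule, which is W. So W is the sl₂-module of dimension n + 1 with n =
D - 2r (`exists_isStandardChain`). The Casimir element acts on it as n(n + 2), and each of the three
operators has the eigenvalue n.

These data, collected in `IsSpinModule`, suffice, and they hold for all cyclic rotations of the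
triple. Starting from an eigenvector of X for d, the operators Y + Z and Y - Z applied alternately
give eigenvectors for d, 2 - d, d - 4, …, which are distinct because d is even. The Casimir element
yields the nonzero scalars of the steps back, so Y and Z are irreducible tridiagonal in this basis
(`IsSpinModule.exists_isStandardBasis`). In an arbitrary eigenbasis with eigenvalues τ, a nonzero
(i, j)-entry of Y or Z forces τ i + τ j = ±2 (`SpinRelations.sq_eq_four`). Evenness of the
eigenvalues then excludes diagonal entries, and their distinctness makes the signs alternate along a
standard basis, which is the Bannai/Ito ratio. -/

/-- The relations of the anticommutator spin algebra. -/
structure SpinRelations {R : Type*} [Ring R] (X Y Z : R) : Prop where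
  xy : X * Y + Y * X = 2 * Z
  yz : Y * Z + Z * Y = 2 * X
  zx : Z * X + X * Z = 2 * Y

theorem SpinRelations.rotate {R : Type*} [Ring R] {X Y Z : R} (h : SpinRelations X Y Z) :
    SpinRelations Y Z X :=
  ⟨h.yz, h.zx, h.xy⟩

/-- A representation of the anticommutator spin algebra of dimension `d + 1`, for even `d`, on which
the Casimir element acts as `d (d + 2)` and such that `d` is an eigenvalue of `X`. -/
structure IsSpinModule {W : Type*} [AddCommGroup W] [Module ℂ W] (d : ℕ)
    (X Y Z : Module.End ℂ W) : Prop where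
  rel : SpinRelations X Y Z
  even : Even d
  finrank : Module.finrank ℂ W = d + 1
  casimir : X * X + Y * Y + Z * Z = ((d : ℂ) * (d + 2)) • (1 : Module.End ℂ W)
  eigen : ∃ u : W, u ≠ 0 ∧ X u = (d : ℂ) • u

/-! ### Spectrum and ladders of eigenvectors in a spin module -/

/-- The eigenvalues of the generators on a `(d+1)`-dimensional representation. -/
def spinEigenvalue (d i : ℕ) : ℤ := (-1) ^ i * ((d : ℤ) - 2 * i)

theorem spinEigenvalue_succ (d i : ℕ) :
    spinEigenvalue d (i + 1) = (-1) ^ i * 2 - spinEigenvalue d i := by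
  simp only [spinEigenvalue, pow_succ]; push_cast; ring

theorem even_spinEigenvalue {d : ℕ} (hd : Even d) (i : ℕ) : Even (spinEigenvalue d i) := by
  obtain ⟨e, rfl⟩ := hd
  exact ⟨(-1) ^ i * ((e : ℤ) - i), by simp only [spinEigenvalue]; push_cast; ring⟩

/-- Within one parity of the index the value is strictly monotone, and for even d the two parities
give the distinct classes d and d + 2 modulo 4. -/
theorem spinEigenvalue_injective {d : ℕ} (hd : Even d) :
    Function.Injective (spinEigenvalue d) := by
  intro i j h
  obtain ⟨e, rfl⟩ := hd
  simp only [spinEigenvalue] at h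
  push_cast at h
  rcases Nat.even_or_odd i with hi | hi <;> rcases Nat.even_or_odd j with hj | hj <;>
    simp only [hi.neg_one_pow, hj.neg_one_pow] at h <;>
    obtain ⟨a, ha⟩ := hi <;> obtain ⟨b, hb⟩ := hj <;> omega

/-- An even index would have to be d + 1, which is odd, and an odd index would have to be -1. This
excludes a step below the bottom of the ladder in `IsSpinModule.sub_apply_eq_zero`. -/
theorem neg_sub_two_ne_spinEigenvalue {d : ℕ} (hd : Even d) (i : ℕ) :
    spinEigenvalue d i ≠ -d - 2 := by
  intro h
  obtain ⟨e, rfl⟩ := hd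
  simp only [spinEigenvalue] at h
  push_cast at h
  rcases Nat.even_or_odd i with hi | hi <;>
    simp only [hi.neg_one_pow] at h <;>
    obtain ⟨a, ha⟩ := hi <;> omega

/-- Successive eigenvectors of `X`, starting from `u`. -/
def ladder {W : Type*} [AddCommGroup W] [Module ℂ W] (Y Z : Module.End ℂ W) (u : W) : ℕ → W
  | 0 => u
  | i + 1 => Y (ladder Y Z u i) + (-1 : ℂ) ^ i • Z (ladder Y Z u i)

section

variable {W : Type*} [AddCommGroup W] [Module ℂ W] {d : ℕ} {X Y Z : Module.End ℂ W}

/-- For s² = 1 the relations combine to X(Y + sZ) = -(Y + sZ)X + 2s(Y + sZ), so Y + sZ reflects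
eigenvalues of X about s. -/
theorem SpinRelations.apply_shift (h : SpinRelations X Y Z) {s θ : ℂ} (hs : s * s = 1) {u : W}
    (hu : X u = θ • u) : X (Y u + s • Z u) = (2 * s - θ) • (Y u + s • Z u) := by
  have h1 := LinearMap.congr_fun h.xy u
  have h2 := LinearMap.congr_fun h.zx u
  simp only [LinearMap.add_apply, Module.End.mul_apply, hu, map_smul, two_mul] at h1 h2
  have h1' : X (Y u) = Z u + Z u - θ • Y u := eq_sub_of_add_eq h1
  have h2' : X (Z u) = Y u + Y u - θ • Z u := by rw [← h2]; abel
  rw [map_add, map_smul, h1', h2']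
  match_scalars
  · linear_combination (-2 : ℂ) * hs
  · ring

/-- Here (Y + sZ)² = Y² + Z² + s(YZ + ZY) = ω - X² + 2sX: the same shift applied twice returns to
the starting line. -/
theorem SpinRelations.apply_shift_shift (h : SpinRelations X Y Z) {s θ ω : ℂ} (hs : s * s = 1)
    (hω : X * X + Y * Y + Z * Z = ω • (1 : Module.End ℂ W)) {u : W} (hu : X u = θ • u) :
    Y (Y u + s • Z u) + s • Z (Y u + s • Z u) = (ω - θ ^ 2 + 2 * s * θ) • u := by
  have h1 := LinearMap.congr_fun h.yz u
  have h2 := LinearMap.congr_fun hω u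
  simp only [LinearMap.add_apply, Module.End.mul_apply, hu, map_smul, two_mul,
    LinearMap.smul_apply, Module.End.one_apply] at h1 h2
  have h1' : Y (Z u) = θ • u + θ • u - Z (Y u) := eq_sub_of_add_eq h1
  have h2' : Y (Y u) = ω • u - θ • θ • u - Z (Z u) := by rw [← h2]; abel
  simp only [map_add, map_smul, h1', h2']
  match_scalars
  · ring
  · linear_combination hs
  · ring

theorem neg_one_pow_mul_self_complex (i : ℕ) : (-1 : ℂ) ^ i * (-1) ^ i = 1 := by
  rw [← mul_pow]; simp

theorem SpinRelations.apply_ladder (h : SpinRelations X Y Z) {u : W} (hu : X u = (d : ℂ) • u)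
    (i : ℕ) : X (ladder Y Z u i) = (spinEigenvalue d i : ℂ) • ladder Y Z u i := by
  induction i with
  | zero => simp [ladder, spinEigenvalue, hu]
  | succ i ih =>
    rw [ladder, h.apply_shift (neg_one_pow_mul_self_complex i) ih, spinEigenvalue_succ]
    push_cast; rw [mul_comm]

/-- The coefficients of the downward steps of a ladder. -/
def ladderCoeff (d i : ℕ) : ℂ := 4 * (i + 1) * (d - i)

theorem ladderCoeff_ne_zero {i : ℕ} (hi : i < d) : ladderCoeff d i ≠ 0 := by
  have h1 : (i : ℂ) + 1 ≠ 0 := by exact_mod_cast Nat.succ_ne_zero i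
  have h2 : (d : ℂ) - i ≠ 0 := sub_ne_zero.2 (by exact_mod_cast hi.ne')
  exact mul_ne_zero (mul_ne_zero (by norm_num) h1) h2

/-- The sign is the one that led from i to i + 1, so this is a double shift. Its scalar d(d + 2) -
θ² + 2(-1)^i θ, with θ = (-1)^i (d - 2i), factors as 4(i + 1)(d - i). -/
theorem IsSpinModule.shift_ladder_succ (h : IsSpinModule d X Y Z) {u : W}
    (hu : X u = (d : ℂ) • u) (i : ℕ) :
    Y (ladder Y Z u (i + 1)) + (-1 : ℂ) ^ i • Z (ladder Y Z u (i + 1)) =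
      ladderCoeff d i • ladder Y Z u i := by
  have hs := neg_one_pow_mul_self_complex i
  rw [ladder, h.rel.apply_shift_shift hs h.casimir (h.rel.apply_ladder hu i)]
  congr 1
  simp only [spinEigenvalue, ladderCoeff]
  push_cast
  linear_combination (-(d - 2 * i : ℂ) ^ 2 + 2 * (d - 2 * i)) * hs

theorem IsSpinModule.ladder_ne_zero (h : IsSpinModule d X Y Z) {u : W} (hu0 : u ≠ 0)
    (hu : X u = (d : ℂ) • u) (i : ℕ) (hi : i ≤ d) : ladder Y Z u i ≠ 0 := by
  induction i with
  | zero => exact hu0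
  | succ i ih =>
    intro h0
    have := h.shift_ladder_succ hu i
    rw [h0] at this
    simp only [map_zero, smul_zero, add_zero] at this
    exact smul_ne_zero (ladderCoeff_ne_zero hi) (ih (by omega)) this.symm

theorem IsSpinModule.linearIndependent (h : IsSpinModule d X Y Z) {u : W} (hu0 : u ≠ 0)
    (hu : X u = (d : ℂ) • u) :
    LinearIndependent ℂ (fun i : Fin (d + 1) => ladder Y Z u i) := by
  refine Module.End.eigenvectors_linearIndependent' X
    (fun i : Fin (d + 1) => (spinEigenvalue d i : ℂ)) ?_ _ ?_
  · intro i j hij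
    exact Fin.ext (spinEigenvalue_injective h.even (Int.cast_injective hij))
  · intro i
    exact ⟨Module.End.mem_eigenspace_iff.2 (h.rel.apply_ladder hu i),
      h.ladder_ne_zero hu0 hu i (by omega)⟩

/-- The basis of a spin module formed by a ladder. -/
noncomputable def IsSpinModule.basis (h : IsSpinModule d X Y Z) {u : W} (hu0 : u ≠ 0)
    (hu : X u = (d : ℂ) • u) : Module.Basis (Fin (d + 1)) ℂ W :=
  haveI : FiniteDimensional ℂ W := Module.finite_of_finrank_pos (by rw [h.finrank]; omega)
  basisOfLinearIndependentOfCardEqFinrank (h.linearIndependent hu0 hu) (by simp [h.finrank])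

theorem IsSpinModule.basis_apply (h : IsSpinModule d X Y Z) {u : W} (hu0 : u ≠ 0)
    (hu : X u = (d : ℂ) • u) (i : Fin (d + 1)) : h.basis hu0 hu i = ladder Y Z u i := by
  simp [IsSpinModule.basis]

/-- An eigenvector is a nonzero combination of basis eigenvectors with the same eigenvalue. -/
theorem exists_eigenvalue_eq {ι : Type*} (b : Module.Basis ι ℂ W)
    {τ : ι → ℂ} (hb : ∀ i, X (b i) = τ i • b i) {w : W} (hw : w ≠ 0) {μ : ℂ}
    (hμ : X w = μ • w) : ∃ i, τ i = μ := by
  have key : ∀ i, b.repr (X w) i = τ i * b.repr w i := by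
    intro i
    have : (b.coord i) ∘ₗ X = τ i • b.coord i := by
      classical
      refine b.ext fun j => ?_
      by_cases hij : j = i
      · subst hij; simp [hb]
      · simp [hb, hij]
    simpa using LinearMap.congr_fun this w
  by_contra! hne
  refine hw (b.ext_elem fun i => ?_)
  have h1 := key i
  rw [hμ] at h1
  simp only [map_smul, Finsupp.smul_apply, smul_eq_mul] at h1
  have : (τ i - μ) * b.repr w i = 0 := by rw [sub_mul, h1, sub_self]
  simpa [sub_ne_zero.2 (hne i)] using this

theorem IsSpinModule.eq_zero_of_apply (h : IsSpinModule d X Y Z) {w : W} {μ : ℤ}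
    (hμ : X w = (μ : ℂ) • w) (hne : ∀ i ≤ d, spinEigenvalue d i ≠ μ) : w = 0 := by
  obtain ⟨u, hu0, hu⟩ := h.eigen
  by_contra hw
  obtain ⟨i, hi⟩ := exists_eigenvalue_eq (h.basis hu0 hu) (X := X)
    (τ := fun i => (spinEigenvalue d i : ℂ))
    (fun i => by rw [h.basis_apply]; exact h.rel.apply_ladder hu i) hw hμ
  exact hne i (by omega) (by exact_mod_cast hi)

theorem IsSpinModule.ladder_succ_eq_zero (h : IsSpinModule d X Y Z) {u : W}
    (hu : X u = (d : ℂ) • u) : ladder Y Z u (d + 1) = 0 :=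
  h.eq_zero_of_apply (h.rel.apply_ladder hu (d + 1)) fun i hi he => by
    have := spinEigenvalue_injective h.even he; omega

/-- The shift with s = -1 sends the eigenvalue d to -d - 2, which is not in the spectrum. -/
theorem IsSpinModule.sub_apply_eq_zero (h : IsSpinModule d X Y Z) {u : W}
    (hu : X u = (d : ℂ) • u) : Y u - Z u = 0 := by
  have := h.rel.apply_shift (s := -1) (by norm_num) hu
  refine h.eq_zero_of_apply (μ := -d - 2) ?_
    (fun i _ => neg_sub_two_ne_spinEigenvalue h.even i)
  have e : Y u + (-1 : ℂ) • Z u = Y u - Z u := by module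
  rw [e] at this
  rw [this]; push_cast; congr 1; ring

theorem IsSpinModule.apply_ladder_zero (h : IsSpinModule d X Y Z) {u : W}
    (hu : X u = (d : ℂ) • u) :
    Y (ladder Y Z u 0) = (1 / 2 : ℂ) • ladder Y Z u 1 ∧
      Z (ladder Y Z u 0) = (1 / 2 : ℂ) • ladder Y Z u 1 := by
  have := sub_eq_zero.1 (h.sub_apply_eq_zero hu)
  simp only [ladder, this, pow_zero, one_smul]
  constructor <;> module

/-- Of Y + Z and Y - Z, one moves the ladder vector up and the other moves it down; half the sum and
half the difference isolate Y and Z. -/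
theorem IsSpinModule.apply_ladder_succ (h : IsSpinModule d X Y Z) {u : W}
    (hu : X u = (d : ℂ) • u) (i : ℕ) :
    Y (ladder Y Z u (i + 1)) = (1 / 2 : ℂ) • ladder Y Z u (i + 2) +
        (ladderCoeff d i / 2) • ladder Y Z u i ∧
      Z (ladder Y Z u (i + 1)) = ((-1) ^ (i + 1) / 2 : ℂ) • ladder Y Z u (i + 2) +
        ((-1) ^ i * ladderCoeff d i / 2) • ladder Y Z u i := by
  have h1 := h.shift_ladder_succ hu i
  have hs := neg_one_pow_mul_self_complex i
  have h2 : ladder Y Z u (i + 2) = Y (ladder Y Z u (i + 1)) +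
    (-1 : ℂ) ^ (i + 1) • Z (ladder Y Z u (i + 1)) := rfl
  simp only [h2, mul_smul, div_eq_mul_inv,
    mul_comm _ (2 : ℂ)⁻¹, ← h1, pow_succ]
  constructor
  · module
  · match_scalars
    · linear_combination -hs
    · ring

theorem IsSpinModule.exists_isStandardBasis (h : IsSpinModule d X Y Z) :
    ∃ b : Module.Basis (Fin (d + 1)) ℂ W, IsStandardBasis b X Y Z := by
  obtain ⟨u, hu0, hu⟩ := h.eigen
  set b := h.basis hu0 hu with hb
  have hbi : ∀ i, b i = ladder Y Z u i := h.basis_apply hu0 hu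
  -- The bound includes d + 1, where the ladder vector is zero and no index matches, so the last
  -- column needs no separate treatment.
  have hr : ∀ n ≤ d + 1, ∀ i : Fin (d + 1),
      b.repr (ladder Y Z u n) i = if n = i then 1 else 0 := by
    intro n hn i
    rcases hn.lt_or_eq with hn | rfl
    · have := hbi ⟨n, hn⟩
      simp only at this
      rw [← this, b.repr_self, Finsupp.single_apply]
      simp [Fin.ext_iff]
    · simp [h.ladder_succ_eq_zero hu, i.2.ne']
  have hzero : ∀ i j : Fin (d + 1), (j : ℕ) = 0 →
      LinearMap.toMatrix b b Y i j = 1 / 2 * (if 1 = (i : ℕ) then 1 else 0) ∧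
      LinearMap.toMatrix b b Z i j = 1 / 2 * (if 1 = (i : ℕ) then 1 else 0) := by
    intro i j hj
    obtain ⟨h1, h2⟩ := h.apply_ladder_zero hu
    rw [LinearMap.toMatrix_apply, LinearMap.toMatrix_apply, hbi, hj, h1, h2, map_smul,
      Finsupp.smul_apply, hr 1 (by omega), smul_eq_mul]
    exact ⟨rfl, rfl⟩
  have hsucc : ∀ (i j : Fin (d + 1)) (k : ℕ), (j : ℕ) = k + 1 →
      LinearMap.toMatrix b b Y i j = 1 / 2 * (if k + 2 = (i : ℕ) then 1 else 0) +
        ladderCoeff d k / 2 * (if k = (i : ℕ) then 1 else 0) ∧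
      LinearMap.toMatrix b b Z i j = (-1) ^ (k + 1) / 2 * (if k + 2 = (i : ℕ) then 1 else 0) +
        (-1) ^ k * ladderCoeff d k / 2 * (if k = (i : ℕ) then 1 else 0) := by
    intro i j k hj
    obtain ⟨h1, h2⟩ := h.apply_ladder_succ hu k
    rw [LinearMap.toMatrix_apply, LinearMap.toMatrix_apply, hbi, hj, h1, h2, map_add, map_add,
      map_smul, map_smul, map_smul, map_smul]
    simp only [Finsupp.add_apply, Finsupp.smul_apply, hr k (by omega), hr (k + 2) (by omega),
      smul_eq_mul, and_self]
  have htri : ∀ i j : Fin (d + 1), ¬ ((i : ℕ) ≤ (j : ℕ) + 1 ∧ (j : ℕ) ≤ (i : ℕ) + 1) →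
      LinearMap.toMatrix b b Y i j = 0 ∧ LinearMap.toMatrix b b Z i j = 0 := by
    intro i j hij
    rcases hj : (j : ℕ) with _ | k
    · rw [(hzero i j hj).1, (hzero i j hj).2, if_neg (by omega)]
      simp
    · rw [(hsucc i j k hj).1, (hsucc i j k hj).2, if_neg (by omega), if_neg (by omega)]
      simp
  have hup : ∀ i j : Fin (d + 1), (i : ℕ) + 1 = (j : ℕ) →
      LinearMap.toMatrix b b Y i j ≠ 0 ∧ LinearMap.toMatrix b b Z i j ≠ 0 := by
    intro i j hij
    have hc : ladderCoeff d i ≠ 0 := ladderCoeff_ne_zero (by omega)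
    rw [(hsucc i j i hij.symm).1, (hsucc i j i hij.symm).2, if_neg (by omega), if_pos rfl]
    simp [hc]
  have hdown : ∀ i j : Fin (d + 1), (i : ℕ) + 1 = (j : ℕ) →
      LinearMap.toMatrix b b Y j i ≠ 0 ∧ LinearMap.toMatrix b b Z j i ≠ 0 := by
    intro j i hij
    rcases hj : (j : ℕ) with _ | k
    · rw [(hzero i j hj).1, (hzero i j hj).2, if_pos (by omega)]
      simp
    · rw [(hsucc i j k hj).1, (hsucc i j k hj).2, if_pos (by omega), if_neg (by omega)]
      simp
  refine ⟨b, ?_, ⟨fun i j hne => ?_, fun i j hij => ⟨(hup i j hij).1, (hdown i j hij).1⟩⟩,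
    ⟨fun i j hne => ?_, fun i j hij => ⟨(hup i j hij).2, (hdown i j hij).2⟩⟩⟩
  · intro i j hij
    rw [LinearMap.toMatrix_apply, hbi, h.rel.apply_ladder hu, map_smul, Finsupp.smul_apply,
      hr _ (by omega), if_neg (fun e => hij (Fin.ext e.symm)), smul_zero]
  · by_contra hij
    exact hne (htri i j hij).1
  · by_contra hij
    exact hne (htri i j hij).2

/-! ### Arbitrary standard bases: zero diagonals and the eigenvalue ratio -/

theorem apply_eq_smul_of_isDiag {n : ℕ} {b : Module.Basis (Fin n) ℂ W}
    (hX : (LinearMap.toMatrix b b X).IsDiag) (i : Fin n) :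
    X (b i) = LinearMap.toMatrix b b X i i • b i := by
  refine b.ext_elem fun j => ?_
  rw [map_smul, Finsupp.smul_apply, b.repr_self, Finsupp.single_apply, ← LinearMap.toMatrix_apply]
  by_cases hij : i = j
  · subst hij; simp
  · rw [hX (Ne.symm hij), if_neg hij, smul_zero]

/-- In an eigenbasis for `X` of a spin module, the eigenvalues are distinct even integers. -/
theorem IsSpinModule.eigenvalue_of_basis (h : IsSpinModule d X Y Z) {n : ℕ}
    {b : Module.Basis (Fin n) ℂ W} {τ : Fin n → ℂ} (hb : ∀ i, X (b i) = τ i • b i) :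
    Function.Injective τ ∧ ∀ i, ∃ m : ℤ, Even m ∧ τ i = m := by
  obtain ⟨u, hu0, hu⟩ := h.eigen
  have hn : n = d + 1 := by
    rw [← h.finrank, Module.finrank_eq_card_basis b, Fintype.card_fin]
  subst hn
  -- Every ladder eigenvalue occurs among the τ j. There are as many distinct ones as basis vectors,
  -- so the choice of j is a bijection and τ is a rearrangement of them.
  have hex : ∀ i : Fin (d + 1), ∃ j, τ j = spinEigenvalue d i := fun i =>
    exists_eigenvalue_eq b hb (h.ladder_ne_zero hu0 hu i (by omega)) (h.rel.apply_ladder hu i)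
  choose σ hσ using hex
  have hinj : Function.Injective σ := fun i j hij => by
    have := (hσ i).symm.trans ((congrArg τ hij).trans (hσ j))
    exact Fin.ext (spinEigenvalue_injective h.even (Int.cast_injective this))
  have hsurj := Finite.surjective_of_injective hinj
  refine ⟨fun i j hij => ?_, fun i => ?_⟩
  · obtain ⟨i, rfl⟩ := hsurj i
    obtain ⟨j, rfl⟩ := hsurj j
    rw [hσ, hσ] at hij
    rw [Fin.ext (spinEigenvalue_injective h.even (Int.cast_injective hij))]
  · obtain ⟨i, rfl⟩ := hsurj i
    exact ⟨_, even_spinEigenvalue h.even i, hσ i⟩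

theorem SpinRelations.toMatrix_apply (h : SpinRelations X Y Z) {n : ℕ}
    {b : Module.Basis (Fin n) ℂ W} {τ : Fin n → ℂ} (hb : ∀ i, X (b i) = τ i • b i)
    (i j : Fin n) :
    (τ i + τ j) * LinearMap.toMatrix b b Y i j = 2 * LinearMap.toMatrix b b Z i j ∧
      (τ i + τ j) * LinearMap.toMatrix b b Z i j = 2 * LinearMap.toMatrix b b Y i j := by
  have hD : LinearMap.toMatrix b b X = Matrix.diagonal τ := by
    ext i j
    rw [LinearMap.toMatrix_apply, hb, map_smul, Finsupp.smul_apply, b.repr_self,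
      Finsupp.single_apply, Matrix.diagonal_apply]
    by_cases hij : i = j
    · subst hij; simp
    · simp [hij, Ne.symm hij]
  have h1 := congrArg (fun M => LinearMap.toMatrix b b M i j) h.xy
  have h2 := congrArg (fun M => LinearMap.toMatrix b b M i j) h.zx
  simp only [two_mul, map_add, LinearMap.toMatrix_mul, hD, Matrix.add_apply,
    Matrix.diagonal_mul, Matrix.mul_diagonal] at h1 h2
  exact ⟨by linear_combination h1, by linear_combination h2⟩

/-- The two identities of `SpinRelations.toMatrix_apply` exchange the entries of Y and Z up to the
factor (τ i + τ j)/2, so both entries are annihilated by (τ i + τ j)² - 4. -/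
theorem SpinRelations.sq_eq_four (h : SpinRelations X Y Z) {n : ℕ}
    {b : Module.Basis (Fin n) ℂ W} {τ : Fin n → ℂ} (hb : ∀ i, X (b i) = τ i • b i)
    (i j : Fin n)
    (hne : LinearMap.toMatrix b b Y i j ≠ 0 ∨ LinearMap.toMatrix b b Z i j ≠ 0) :
    τ i + τ j = 2 ∨ τ i + τ j = -2 := by
  obtain ⟨h1, h2⟩ := h.toMatrix_apply hb i j
  have : (τ i + τ j - 2) * (τ i + τ j + 2) = 0 := by
    rcases hne with hne | hne <;> refine (mul_eq_zero.1 ?_).resolve_right hne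
    · linear_combination (τ i + τ j) * h1 + 2 * h2
    · linear_combination (τ i + τ j) * h2 + 2 * h1
  rcases mul_eq_zero.1 this with h | h
  · exact .inl (sub_eq_zero.1 h)
  · exact .inr (eq_neg_of_add_eq_zero_left h)

/-- A nonzero diagonal entry would force 2 τ i = ±2, but τ i is an even integer. -/
theorem IsSpinModule.toMatrix_diag (h : IsSpinModule d X Y Z) {n : ℕ}
    {b : Module.Basis (Fin n) ℂ W} (hX : (LinearMap.toMatrix b b X).IsDiag) (i : Fin n) :
    LinearMap.toMatrix b b Y i i = 0 ∧ LinearMap.toMatrix b b Z i i = 0 := by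
  have hb := apply_eq_smul_of_isDiag hX
  obtain ⟨m, ⟨k, rfl⟩, hm⟩ := (h.eigenvalue_of_basis hb).2 i
  by_contra hne
  rw [not_and_or] at hne
  have := h.rel.sq_eq_four hb i i hne
  simp only [hm] at this
  norm_cast at this
  omega

theorem IsSpinModule.isBipartiteMatrix (h : IsSpinModule d X Y Z) {n : ℕ}
    {b : Module.Basis (Fin (n + 1)) ℂ W} (hb : IsStandardBasis b X Y Z) :
    IsBipartiteMatrix (LinearMap.toMatrix b b Y) ∧
      IsBipartiteMatrix (LinearMap.toMatrix b b Z) :=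
  ⟨⟨hb.2.1.1, fun i => (h.toMatrix_diag hb.1 i).1⟩,
    ⟨hb.2.2.1, fun i => (h.toMatrix_diag hb.1 i).2⟩⟩

theorem IsSpinModule.ratio_eq (h : IsSpinModule d X Y Z) {n : ℕ}
    {b : Module.Basis (Fin (n + 1)) ℂ W} (hb : IsStandardBasis b X Y Z)
    {τ : Fin (n + 1) → ℂ} (hτ : ∀ i, X (b i) = τ i • b i) (i : ℕ) (h2 : 2 ≤ i) (hn : i + 1 ≤ n) :
    (τ ⟨i - 2, by omega⟩ - τ ⟨i + 1, by omega⟩) /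
      (τ ⟨i - 1, by omega⟩ - τ ⟨i, by omega⟩) = -1 := by
  obtain ⟨hinj, -⟩ := h.eigenvalue_of_basis hτ
  have hstep : ∀ j k : Fin (n + 1), (j : ℕ) + 1 = k → τ j + τ k = 2 ∨ τ j + τ k = -2 :=
    fun j k hjk => h.rel.sq_eq_four hτ j k (.inl (hb.2.1.2 j k hjk).1)
  have hne : ∀ j k : Fin (n + 1), (j : ℕ) ≠ k → τ j ≠ τ k :=
    fun j k hjk e => hjk (congrArg _ (hinj e))
  have s1 := hstep ⟨i - 2, by omega⟩ ⟨i - 1, by omega⟩ (by simp only; omega)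
  have s2 := hstep ⟨i - 1, by omega⟩ ⟨i, by omega⟩ (by simp only; omega)
  have s3 := hstep ⟨i, by omega⟩ ⟨i + 1, by omega⟩ rfl
  have n1 := hne ⟨i - 2, by omega⟩ ⟨i, by omega⟩ (by simp only; omega)
  have n2 := hne ⟨i - 1, by omega⟩ ⟨i, by omega⟩ (by simp only; omega)
  have n3 := hne ⟨i - 1, by omega⟩ ⟨i + 1, by omega⟩ (by simp only; omega)
  rw [div_eq_iff (sub_ne_zero.2 n2)]
  generalize τ ⟨i - 2, by omega⟩ = p at *
  generalize τ ⟨i - 1, by omega⟩ = q at *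
  generalize τ ⟨i, by omega⟩ = s at *
  generalize τ ⟨i + 1, by omega⟩ = t at *
  -- Two successive sums of equal sign would make eigenvalues two places apart coincide. Hence the
  -- signs alternate, the first and third sums agree, and that equality is the claim.
  rcases s1 with s1 | s1 <;> rcases s2 with s2 | s2 <;> rcases s3 with s3 | s3 <;>
    first
    | exact absurd (by linear_combination s1 - s2) n1
    | exact absurd (by linear_combination s2 - s3) n3
    | linear_combination s1 - s3

theorem IsSpinModule.isLeonardTriple (h : IsSpinModule d X Y Z)
    (h' : IsSpinModule d Y Z X) (h'' : IsSpinModule d Z X Y) : IsLeonardTriple X Y Z :=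
  ⟨⟨d, h.exists_isStandardBasis⟩, ⟨d, h'.exists_isStandardBasis⟩, ⟨d, h''.exists_isStandardBasis⟩⟩

theorem IsSpinModule.isTotallyBipartite (h : IsSpinModule d X Y Z)
    (h' : IsSpinModule d Y Z X) (h'' : IsSpinModule d Z X Y) : IsTotallyBipartite X Y Z :=
  { h.isLeonardTriple h' h'' with
    bip_first := fun _ _ hb => h.isBipartiteMatrix hb
    bip_second := fun _ _ hb => h'.isBipartiteMatrix hb
    bip_third := fun _ _ hb => h''.isBipartiteMatrix hb }

theorem SpinRelations.satisfiesAnticommutators (h : SpinRelations X Y Z) :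
    SatisfiesAnticommutators X Y Z (2 : ℂ) 2 2 := by
  have e : ∀ M : Module.End ℂ W, 2 * M = (2 : ℂ) • M := fun M => by rw [two_mul, two_smul]
  exact ⟨h.xy.trans (e _), h.yz.trans (e _), h.zx.trans (e _)⟩

theorem IsSpinModule.isNormalizedLeonardTriple (h : IsSpinModule d X Y Z)
    (h' : IsSpinModule d Y Z X) (h'' : IsSpinModule d Z X Y) : IsNormalizedLeonardTriple X Y Z where
  total := .inl (h.isTotallyBipartite h' h'')
  bannaiIto :=
    { h.isLeonardTriple h' h'' with
      ratio := fun _ _ hb _ hθ i h2 hd => h.ratio_eq hb hθ i h2 hd }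
  scalars := h.rel.satisfiesAnticommutators

end

/-! ### Coordinate flips and distances in the hypercube -/

section Cube

variable {D : ℕ}

/-- Flip the `j`-th coordinate of a vertex. -/
def flipAt (y : Fin D → Bool) (j : Fin D) : Fin D → Bool := Function.update y j (!y j)

theorem flipAt_same (y : Fin D → Bool) (j : Fin D) : flipAt y j j = !y j := by
  simp [flipAt]

theorem flipAt_of_ne (y : Fin D → Bool) {j l : Fin D} (h : l ≠ j) : flipAt y j l = y l := by
  simp [flipAt, h]

theorem flipAt_flipAt_same (y : Fin D → Bool) (j : Fin D) : flipAt (flipAt y j) j = y := by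
  simp [flipAt]

theorem flipAt_comm (y : Fin D → Bool) (j l : Fin D) :
    flipAt (flipAt y j) l = flipAt (flipAt y l) j := by
  funext m
  by_cases hj : m = j <;> by_cases hl : m = l <;> by_cases hjl : j = l <;>
    simp_all [flipAt, Function.update_apply]

theorem hammingDist_flipAt_of_eq {x y : Fin D → Bool} {j : Fin D} (h : y j = x j) :
    hammingDist x (flipAt y j) = hammingDist x y + 1 := by
  have : (Finset.univ.filter fun i => x i ≠ flipAt y j i) =
      insert j (Finset.univ.filter fun i => x i ≠ y i) := by
    ext i
    by_cases hi : i = j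
    · subst hi; simp [flipAt_same, h]
    · simp [flipAt_of_ne y hi, hi]
  unfold hammingDist
  rw [this, Finset.card_insert_of_notMem (by simp [h])]

theorem hammingDist_flipAt_of_ne {x y : Fin D → Bool} {j : Fin D} (h : y j ≠ x j) :
    hammingDist x (flipAt y j) + 1 = hammingDist x y := by
  have h' : flipAt y j j = x j := by
    rw [flipAt_same]; revert h; cases y j <;> cases x j <;> simp
  have := hammingDist_flipAt_of_eq h'
  rw [flipAt_flipAt_same] at this
  exact this.symm

theorem hammingDist_flipAt_self (y : Fin D → Bool) (j : Fin D) :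
    hammingDist y (flipAt y j) = 1 := by
  rw [hammingDist_flipAt_of_eq rfl, hammingDist_self]

theorem flipAt_injective (y : Fin D → Bool) : Function.Injective (flipAt y) := by
  intro j l h
  by_contra hjl
  have := congrFun h j
  rw [flipAt_same, flipAt_of_ne y hjl] at this
  simp at this

theorem hammingDist_eq_one_iff {y z : Fin D → Bool} :
    hammingDist y z = 1 ↔ ∃ j, flipAt y j = z := by
  constructor
  · intro h
    have hne : y ≠ z := by rintro rfl; simp at h
    obtain ⟨j, hj⟩ := Function.ne_iff.1 hne
    refine ⟨j, ?_⟩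
    have := hammingDist_flipAt_of_ne (x := z) hj
    rw [hammingDist_comm z y, h] at this
    exact (hammingDist_eq_zero.1 (by omega)).symm
  · rintro ⟨j, rfl⟩
    exact hammingDist_flipAt_self y j

theorem hammingDist_le_walk_length {y z : Fin D → Bool} (p : (hypercube D).Walk y z) :
    hammingDist y z ≤ p.length := by
  induction p with
  | nil => simp
  | cons h p ih =>
    rename_i u v w
    have h1 : hammingDist u v = 1 := h
    have := hammingDist_triangle u v w
    rw [SimpleGraph.Walk.length_cons]
    omega

theorem exists_walk_length_eq_hammingDist (n : ℕ) (y z : Fin D → Bool)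
    (h : hammingDist y z = n) : ∃ p : (hypercube D).Walk y z, p.length = n := by
  induction n generalizing y with
  | zero =>
    obtain rfl := hammingDist_eq_zero.1 h
    exact ⟨.nil, rfl⟩
  | succ n ih =>
    have hne : y ≠ z := by rintro rfl; simp at h
    obtain ⟨j, hj⟩ := Function.ne_iff.1 hne
    have hd := hammingDist_flipAt_of_ne (x := z) hj
    rw [hammingDist_comm z y, h, hammingDist_comm] at hd
    obtain ⟨p, hp⟩ := ih (flipAt y j) (by omega)
    have hadj : (hypercube D).Adj y (flipAt y j) := hammingDist_flipAt_self y j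
    exact ⟨.cons hadj p, by rw [SimpleGraph.Walk.length_cons, hp]⟩

/-- Flipping the differing coordinates one by one gives a walk of this length; the triangle
inequality along a walk shows that none is shorter. -/
theorem hypercube_dist (y z : Fin D → Bool) : (hypercube D).dist y z = hammingDist y z := by
  obtain ⟨p, hp⟩ := exists_walk_length_eq_hammingDist _ y z rfl
  refine le_antisymm (hp ▸ SimpleGraph.dist_le p) ?_
  obtain ⟨q, hq⟩ := p.reachable.exists_walk_length_eq_dist
  exact hq ▸ hammingDist_le_walk_length q

theorem toLin'_cubeA_apply (f : (Fin D → Bool) → ℂ) (y : Fin D → Bool) :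
    Matrix.toLin' (cubeA D) f y = ∑ j, f (flipAt y j) := by
  have him : (Finset.univ.filter fun z => hammingDist y z = 1) =
      Finset.univ.image (flipAt y) := by
    ext z; simp [hammingDist_eq_one_iff]
  rw [Matrix.toLin'_apply, Matrix.mulVec, dotProduct]
  simp only [cubeA, distanceMatrix, Matrix.of_apply, hypercube_dist, ite_mul, one_mul, zero_mul]
  rw [← Finset.sum_filter, him, Finset.sum_image (fun _ _ _ _ h => flipAt_injective y h)]

theorem toLin'_diagonal_apply {X : Type*} [Fintype X] [DecidableEq X] (c f : X → ℂ) (y : X) :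
    Matrix.toLin' (Matrix.diagonal c) f y = c y * f y := by
  rw [Matrix.toLin'_apply, Matrix.mulVec_diagonal]

/-! ### Characters and the entries of polynomials in the adjacency matrix -/

section Characters

/-- The sign that tells whether two vertices agree in a coordinate. -/
def agreeSign (x y : Fin D → Bool) (j : Fin D) : ℂ := if y j = x j then 1 else -1

theorem agreeSign_mul_self (x y : Fin D → Bool) (j : Fin D) :
    agreeSign x y j * agreeSign x y j = 1 := by
  unfold agreeSign; split_ifs <;> norm_num

theorem sum_agreeSign (x y : Fin D → Bool) :
    ∑ j, agreeSign x y j = (D : ℂ) - 2 * hammingDist x y := by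
  have : ∀ j, agreeSign x y j = 1 - 2 * (if x j ≠ y j then 1 else 0) := by
    intro j
    unfold agreeSign
    by_cases h : x j = y j
    · simp [h]
    · rw [if_neg (Ne.symm h), if_pos h]; norm_num
  simp only [this, Finset.sum_sub_distrib, ← Finset.mul_sum, Finset.sum_boole]
  simp [hammingDist]

theorem prod_agreeSign (x y : Fin D → Bool) :
    ∏ j, agreeSign x y j = (-1) ^ hammingDist x y := by
  have : ∀ j, agreeSign x y j = if x j ≠ y j then -1 else 1 := by
    intro j
    by_cases h : x j = y j
    · simp [agreeSign, h]
    · rw [agreeSign, if_neg (Ne.symm h), if_pos h]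
  simp only [this, Finset.prod_ite, Finset.prod_const, one_pow, mul_one]
  rfl

/-- The characters of the hypercube. -/
def cubeChar (s : Finset (Fin D)) (y : Fin D → Bool) : ℂ :=
  ∏ j ∈ s, agreeSign (fun _ => false) y j

theorem agreeSign_false_mul (x y : Fin D → Bool) (j : Fin D) :
    agreeSign (fun _ => false) x j * agreeSign (fun _ => false) y j = agreeSign x y j := by
  unfold agreeSign
  cases x j <;> cases y j <;> simp

theorem cubeChar_mul (s : Finset (Fin D)) (x y : Fin D → Bool) :
    cubeChar s x * cubeChar s y = ∏ j ∈ s, agreeSign x y j := by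
  simp only [cubeChar, ← Finset.prod_mul_distrib, agreeSign_false_mul]

theorem cubeChar_flipAt (s : Finset (Fin D)) (y : Fin D → Bool) (j : Fin D) :
    cubeChar s (flipAt y j) = (if j ∈ s then -1 else 1) * cubeChar s y := by
  have h1 : ∀ l, l ≠ j →
      agreeSign (fun _ => false) (flipAt y j) l = agreeSign (fun _ => false) y l := by
    intro l hl
    simp [agreeSign, flipAt_of_ne y hl]
  have h2 : agreeSign (fun _ => false) (flipAt y j) j = -agreeSign (fun _ => false) y j := by
    simp only [agreeSign, flipAt_same]
    cases y j <;> simp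
  unfold cubeChar
  split_ifs with hj
  · rw [← Finset.mul_prod_erase s _ hj, ← Finset.mul_prod_erase s _ hj, h2,
      Finset.prod_congr rfl fun l hl => h1 l (Finset.ne_of_mem_erase hl)]
    ring
  · rw [one_mul]
    exact Finset.prod_congr rfl fun l hl => h1 l (fun e => hj (e ▸ hl))

theorem toLin'_cubeA_cubeChar (s : Finset (Fin D)) :
    Matrix.toLin' (cubeA D) (cubeChar s) = ((D : ℂ) - 2 * s.card) • cubeChar s := by
  funext y
  rw [toLin'_cubeA_apply, Pi.smul_apply, smul_eq_mul]
  simp only [cubeChar_flipAt, ← Finset.sum_mul]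
  congr 1
  have : ∀ j, (if j ∈ s then (-1 : ℂ) else 1) = 1 - 2 * (if j ∈ s then 1 else 0) := by
    intro j; split_ifs <;> norm_num
  simp only [this, Finset.sum_sub_distrib, ← Finset.mul_sum, Finset.sum_boole]
  simp

/-- Fourier inversion: the sum over s factors as the product over j of 1 + `agreeSign y z j`, which
vanishes as soon as one coordinate differs. -/
theorem single_eq_sum_cubeChar (y : Fin D → Bool) :
    (Pi.single y 1 : (Fin D → Bool) → ℂ) =
      ((2 : ℂ) ^ D)⁻¹ • ∑ s : Finset (Fin D), cubeChar s y • cubeChar s := by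
  funext z
  simp only [Pi.smul_apply, Finset.sum_apply, smul_eq_mul, cubeChar_mul]
  have := Finset.prod_one_add (f := agreeSign y z) (Finset.univ : Finset (Fin D))
  rw [Finset.powerset_univ] at this
  rw [← this]
  by_cases h : z = y
  · subst h
    simp only [Pi.single_eq_same, agreeSign, if_true, Finset.prod_const, Finset.card_univ,
      Fintype.card_fin]
    norm_num
  · obtain ⟨j, hj⟩ := Function.ne_iff.1 h
    rw [Pi.single_eq_of_ne h, Finset.prod_eq_zero (Finset.mem_univ j) (by simp [agreeSign, hj]),
      mul_zero]

open Polynomial in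
/-- The entries of a polynomial in the adjacency matrix of the hypercube. -/
theorem aeval_cubeA_apply (p : ℂ[X]) (x y : Fin D → Bool) :
    (2 : ℂ) ^ D * aeval (cubeA D) p x y =
      ∑ s : Finset (Fin D), p.eval ((D : ℂ) - 2 * s.card) * ∏ j ∈ s, agreeSign x y j := by
  have h1 : aeval (cubeA D) p x y = Matrix.toLin' (aeval (cubeA D) p) (Pi.single y 1) x := by
    simp
  have h2 : Matrix.toLin' (aeval (cubeA D) p) = aeval (Matrix.toLin' (cubeA D)) p :=
    (aeval_algHom_apply (Matrix.toLinAlgEquiv' : Matrix (Fin D → Bool) (Fin D → Bool) ℂ ≃ₐ[ℂ] _)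
      (cubeA D) p).symm
  have h3 : ∀ s : Finset (Fin D), aeval (Matrix.toLin' (cubeA D)) p (cubeChar s) =
      p.eval ((D : ℂ) - 2 * s.card) • cubeChar s := fun s =>
    Module.End.aeval_apply_of_mem_apply_eq_smul (toLin'_cubeA_cubeChar s)
  rw [h1, h2, single_eq_sum_cubeChar, map_smul, map_sum]
  simp only [map_smul, h3, Pi.smul_apply, Finset.sum_apply, smul_eq_mul]
  rw [mul_inv_cancel_left₀ (pow_ne_zero _ two_ne_zero)]
  refine Finset.sum_congr rfl fun s _ => ?_
  rw [← cubeChar_mul]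
  ring

open Polynomial in
-- The polynomial selects the subsets of size D - 1, the complements of singletons. As signs square
-- to 1, the product over the complement of {j} is the full product times the j-th sign; summing
-- over j gives (-1)^k (D - 2k) at distance k.
theorem aeval_cubeA_apply_of_eval {p : ℂ[X]}
    (hp : ∀ m ≤ D, p.eval ((D : ℂ) - 2 * m) = if m + 1 = D then 1 else 0) (x y : Fin D → Bool) :
    (2 : ℂ) ^ D * aeval (cubeA D) p x y =
      (-1) ^ hammingDist x y * ((D : ℂ) - 2 * hammingDist x y) := by
  have himg : (Finset.univ.filter fun s : Finset (Fin D) => s.card + 1 = D) =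
      Finset.univ.image fun j : Fin D => ({j} : Finset (Fin D))ᶜ := by
    ext s
    have hc := Finset.card_compl s
    have hs := Finset.card_le_univ s
    simp only [Fintype.card_fin] at hc hs
    simp only [Finset.mem_filter, Finset.mem_univ, true_and, Finset.mem_image]
    constructor
    · intro h
      obtain ⟨j, hj⟩ := Finset.card_eq_one.1 (show sᶜ.card = 1 by omega)
      exact ⟨j, by rw [← hj, compl_compl]⟩
    · rintro ⟨j, rfl⟩
      rw [compl_compl, Finset.card_singleton] at hc
      omega
  rw [aeval_cubeA_apply]
  have : ∀ s : Finset (Fin D), p.eval ((D : ℂ) - 2 * s.card) * ∏ j ∈ s, agreeSign x y j =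
      if s.card + 1 = D then ∏ j ∈ s, agreeSign x y j else 0 := by
    intro s
    rw [hp _ (by simpa using Finset.card_le_univ s), ite_mul, one_mul, zero_mul]
  simp only [this]
  rw [← Finset.sum_filter, himg, Finset.sum_image (fun i _ j _ h => by simpa using h),
    ← prod_agreeSign, ← sum_agreeSign, Finset.mul_sum]
  refine Finset.sum_congr rfl fun j _ => ?_
  rw [Fintype.prod_eq_mul_prod_compl j (agreeSign x y), mul_comm, ← mul_assoc,
    agreeSign_mul_self, one_mul]

end Characters

/-! ### Identification of the two dual distance matrices -/

/-- The dual adjacency matrix for the second ordering of the eigenvalues. -/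
noncomputable def twistedDual (D : ℕ) (x : Fin D → Bool) :
    Matrix (Fin D → Bool) (Fin D → Bool) ℂ :=
  Matrix.diagonal fun y => (-1) ^ hammingDist x y * ((D : ℂ) - 2 * hammingDist x y)

/-- A common criterion for both orderings: only the idempotent of the eigenvalue 2 - D matters,
whatever its index. -/
theorem dualDistanceMatrix_eq_twistedDual (x : Fin D → Bool) (θ : ℕ → ℂ) (i : ℤ)
    (hi : 0 ≤ i ∧ i ≤ D → ∀ m ≤ D,
      (Lagrange.basis (Finset.range (D + 1)) θ i.toNat).eval ((D : ℂ) - 2 * m) =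
        if m + 1 = D then 1 else 0)
    (hi' : ¬ (0 ≤ i ∧ i ≤ D) → D = 0) :
    dualDistanceMatrix (hypercube D) D θ x i = twistedDual D x := by
  unfold dualDistanceMatrix twistedDual
  congr 1
  funext y
  by_cases h : 0 ≤ i ∧ i ≤ D
  · rw [← aeval_cubeA_apply_of_eval (hi h), primitiveIdempotent, if_pos h]
    simp [cubeA]
  -- The index falls out of range only for D = 0. The idempotent is then 0 by convention, and the
  -- right-hand diagonal vanishes too.
  · obtain rfl := hi' h
    have : hammingDist x y = 0 := hammingDist_eq_zero.2 (Subsingleton.elim _ _)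
    rw [primitiveIdempotent, if_neg h]
    simp [this]

theorem eval_lagrangeBasis {θ : ℕ → ℂ} (hθ : Function.Injective θ) {i j : ℕ} (hi : i ≤ D)
    (hj : j ≤ D) :
    (Lagrange.basis (Finset.range (D + 1)) θ i).eval (θ j) = if i = j then 1 else 0 := by
  split_ifs with h
  · subst h
    exact Lagrange.eval_basis_self hθ.injOn (by simpa using Nat.lt_succ_of_le hi)
  · exact Lagrange.eval_basis_of_ne h (by simpa using Nat.lt_succ_of_le hj)

theorem cubeDual_eq (x : Fin D → Bool) : cubeDual D x ((D : ℤ) - 1) = twistedDual D x := by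
  refine dualDistanceMatrix_eq_twistedDual x _ _ (fun h m hm => ?_)
    (fun h => by omega)
  have hinj : Function.Injective fun j : ℕ => (D : ℂ) - 2 * j := by
    intro i j h
    simpa using h
  rw [eval_lagrangeBasis hinj (by omega) hm]
  congr 1
  simp only [eq_iff_iff]
  omega

theorem cubeB_eq (hD : Even D) (x : Fin D → Bool) : cubeB D x = twistedDual D x := by
  refine dualDistanceMatrix_eq_twistedDual x _ _ (fun h m hm => ?_)
    (fun h => by omega)
  have hinj : Function.Injective fun j : ℕ => (-1 : ℂ) ^ j * ((D : ℂ) - 2 * j) := by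
    intro i j h
    refine spinEigenvalue_injective hD (Int.cast_injective (α := ℂ) ?_)
    simpa [spinEigenvalue] using h
  obtain ⟨e, rfl⟩ := hD
  -- In the alternating ordering, D - 2m stands at position m if m is even and at position D - m if
  -- m is odd.
  rcases Nat.even_or_odd m with he | ho
  · have := eval_lagrangeBasis (D := e + e) hinj (i := 1) (j := m) (by omega) hm
    simp only [he.neg_one_pow, one_mul] at this
    refine this.trans ?_
    obtain ⟨a, rfl⟩ := he
    rw [if_neg (by omega), if_neg (by omega)]
  · have := eval_lagrangeBasis (D := e + e) hinj (i := 1) (j := e + e - m) (by omega) (by omega)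
    have ho' : Odd (e + e - m) := by
      obtain ⟨a, rfl⟩ := ho
      exact ⟨e - a - 1, by omega⟩
    simp only [ho'.neg_one_pow] at this
    rw [Nat.cast_sub hm] at this
    have e1 : (-1 : ℂ) * (((e + e : ℕ) : ℂ) - 2 * (((e + e : ℕ) : ℂ) - m)) =
      ((e + e : ℕ) : ℂ) - 2 * m := by ring
    rw [e1] at this
    refine this.trans ?_
    congr 1
    simp only [eq_iff_iff]
    omega

/-! ### Raising and lowering operators, the sl₂ relations and the parity -/

/-- Multiplication by a function of the distance from `x`. -/
noncomputable def radial (x : Fin D → Bool) (c : ℕ → ℂ) :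
    Module.End ℂ ((Fin D → Bool) → ℂ) :=
  LinearMap.mulLeft ℂ fun y => c (hammingDist x y)

theorem radial_apply (x : Fin D → Bool) (c : ℕ → ℂ) (f : (Fin D → Bool) → ℂ) (y : Fin D → Bool) :
    radial x c f y = c (hammingDist x y) * f y := rfl

/-- The contribution of the `j`-th coordinate to the raising operator. -/
def raiseAt (x : Fin D → Bool) (j : Fin D) : Module.End ℂ ((Fin D → Bool) → ℂ) where
  toFun f y := if y j = x j then 0 else f (flipAt y j)
  map_add' f g := by funext y; simp only [Pi.add_apply]; split_ifs <;> simp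
  map_smul' a f := by funext y; simp only [Pi.smul_apply]; split_ifs <;> simp

/-- The contribution of the `j`-th coordinate to the lowering operator. -/
def lowerAt (x : Fin D → Bool) (j : Fin D) : Module.End ℂ ((Fin D → Bool) → ℂ) where
  toFun f y := if y j = x j then f (flipAt y j) else 0
  map_add' f g := by funext y; simp only [Pi.add_apply]; split_ifs <;> simp
  map_smul' a f := by funext y; simp only [Pi.smul_apply]; split_ifs <;> simp

theorem raiseAt_apply (x : Fin D → Bool) (j : Fin D) (f : (Fin D → Bool) → ℂ)
    (y : Fin D → Bool) : raiseAt x j f y = if y j = x j then 0 else f (flipAt y j) := rfl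

theorem lowerAt_apply (x : Fin D → Bool) (j : Fin D) (f : (Fin D → Bool) → ℂ)
    (y : Fin D → Bool) : lowerAt x j f y = if y j = x j then f (flipAt y j) else 0 := rfl

/-- The raising operator of the hypercube. -/
noncomputable def raise (x : Fin D → Bool) : Module.End ℂ ((Fin D → Bool) → ℂ) :=
  ∑ j, raiseAt x j

/-- The lowering operator of the hypercube. -/
noncomputable def lower (x : Fin D → Bool) : Module.End ℂ ((Fin D → Bool) → ℂ) :=
  ∑ j, lowerAt x j

theorem toLin'_cubeA_eq (x : Fin D → Bool) :
    Matrix.toLin' (cubeA D) = lower x + raise x := by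
  refine LinearMap.ext fun f => funext fun y => ?_
  simp only [toLin'_cubeA_apply, LinearMap.add_apply, Pi.add_apply, lower, raise,
    LinearMap.sum_apply, Finset.sum_apply, ← Finset.sum_add_distrib, lowerAt_apply, raiseAt_apply]
  refine Finset.sum_congr rfl fun j _ => ?_
  split_ifs <;> simp

theorem lowerAt_mul_raiseAt_of_ne (x : Fin D → Bool) {j l : Fin D} (h : j ≠ l) :
    lowerAt x j * raiseAt x l = raiseAt x l * lowerAt x j := by
  refine LinearMap.ext fun f => funext fun y => ?_
  simp only [Module.End.mul_apply, lowerAt_apply, raiseAt_apply, flipAt_of_ne y h,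
    flipAt_of_ne y h.symm, flipAt_comm y j l]
  split_ifs <;> rfl

theorem lowerAt_mul_raiseAt_same (x : Fin D → Bool) (j : Fin D) :
    lowerAt x j * raiseAt x j = raiseAt x j * lowerAt x j +
      LinearMap.mulLeft ℂ fun y => agreeSign x y j := by
  refine LinearMap.ext fun f => funext fun y => ?_
  simp only [Module.End.mul_apply, LinearMap.add_apply, Pi.add_apply, lowerAt_apply,
    raiseAt_apply, flipAt_same, flipAt_flipAt_same, LinearMap.mulLeft_apply, Pi.mul_apply,
    agreeSign]
  cases y j <;> cases x j <;> simp

/-- The weights of the hypercube. -/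
noncomputable def weight (x : Fin D → Bool) : Module.End ℂ ((Fin D → Bool) → ℂ) :=
  radial x fun k => (D : ℂ) - 2 * k

/-- The parity of the distance from `x`. -/
noncomputable def parity (x : Fin D → Bool) : Module.End ℂ ((Fin D → Bool) → ℂ) :=
  radial x fun k => (-1) ^ k

/-- The operators of distinct coordinates commute, and each coordinate contributes its agreement
sign; these signs sum to the weight. -/
theorem lower_mul_raise (x : Fin D → Bool) :
    lower x * raise x = raise x * lower x + weight x := by
  have hw : weight x = ∑ j, LinearMap.mulLeft ℂ fun y => agreeSign x y j := by
    refine LinearMap.ext fun f => funext fun y => ?_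
    rw [weight, radial_apply, ← sum_agreeSign, LinearMap.sum_apply, Finset.sum_apply,
      Finset.sum_mul]
    rfl
  rw [lower, raise, Finset.sum_mul_sum, Finset.sum_mul_sum, hw, Finset.sum_comm,
    ← Finset.sum_add_distrib]
  refine Finset.sum_congr rfl fun l _ => ?_
  -- Spreading the diagonal term over a sum in j allows both sides to be compared term by term.
  have : (LinearMap.mulLeft ℂ fun y => agreeSign x y l) =
      ∑ j, if l = j then (LinearMap.mulLeft ℂ fun y => agreeSign x y j) else 0 := by
    rw [Finset.sum_ite_eq]; simp
  rw [this, ← Finset.sum_add_distrib]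
  refine Finset.sum_congr rfl fun j _ => ?_
  split_ifs with h
  · subst h; exact lowerAt_mul_raiseAt_same x l
  · rw [lowerAt_mul_raiseAt_of_ne x (Ne.symm h), add_zero]

theorem radial_mul_raise (x : Fin D → Bool) {c c' : ℕ → ℂ} (h : ∀ n, c (n + 1) = c' n) :
    radial x c * raise x = raise x * radial x c' := by
  rw [raise, Finset.mul_sum, Finset.sum_mul]
  refine Finset.sum_congr rfl fun j _ => LinearMap.ext fun f => funext fun y => ?_
  simp only [Module.End.mul_apply, radial_apply, raiseAt_apply]
  split_ifs with hj
  · rw [mul_zero]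
  · rw [← hammingDist_flipAt_of_ne hj, h]

theorem radial_mul_lower (x : Fin D → Bool) {c c' : ℕ → ℂ} (h : ∀ n, c n = c' (n + 1)) :
    radial x c * lower x = lower x * radial x c' := by
  rw [lower, Finset.mul_sum, Finset.sum_mul]
  refine Finset.sum_congr rfl fun j _ => LinearMap.ext fun f => funext fun y => ?_
  simp only [Module.End.mul_apply, radial_apply, lowerAt_apply]
  split_ifs with hj
  · rw [hammingDist_flipAt_of_eq hj, h]
  · rw [mul_zero]

theorem radial_mul_radial (x : Fin D → Bool) (c c' : ℕ → ℂ) :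
    radial x c * radial x c' = radial x fun n => c n * c' n :=
  LinearMap.ext fun f => funext fun y => by
    simp only [Module.End.mul_apply, radial_apply, mul_assoc]

theorem radial_smul (x : Fin D → Bool) (a : ℂ) (c : ℕ → ℂ) :
    a • radial x c = radial x fun n => a * c n :=
  LinearMap.ext fun f => funext fun y => by
    simp only [LinearMap.smul_apply, Pi.smul_apply, smul_eq_mul, radial_apply, mul_assoc]

theorem parity_mul_raise (x : Fin D → Bool) : parity x * raise x = -(raise x * parity x) := by
  rw [parity, radial_mul_raise x (c' := fun k => (-1) * (-1) ^ k) (fun n => by ring),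
    ← radial_smul]
  simp

theorem parity_mul_lower (x : Fin D → Bool) : parity x * lower x = -(lower x * parity x) := by
  rw [parity, radial_mul_lower x (c' := fun k => (-1) * (-1) ^ k) (fun n => by ring),
    ← radial_smul]
  simp

theorem parity_mul_self (x : Fin D → Bool) : parity x * parity x = 1 := by
  rw [parity, radial_mul_radial]
  refine LinearMap.ext fun f => funext fun y => ?_
  simp [radial_apply, neg_one_pow_mul_self_complex]

theorem weight_mul_parity (x : Fin D → Bool) : weight x * parity x = parity x * weight x := by
  rw [parity, weight, radial_mul_radial, radial_mul_radial]
  simp only [mul_comm]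

theorem weight_mul_raise (x : Fin D → Bool) :
    weight x * raise x = raise x * weight x - 2 * raise x := by
  have : weight x * raise x = raise x * (weight x - (2 : ℂ) • 1) := by
    have e : weight x - (2 : ℂ) • 1 = radial x fun k => (D : ℂ) - 2 * k - 2 :=
      LinearMap.ext fun f => funext fun y => by
        simp only [LinearMap.sub_apply, Pi.sub_apply, LinearMap.smul_apply, Pi.smul_apply, weight,
          radial_apply, Module.End.one_apply, smul_eq_mul]
        ring
    rw [e, weight, radial_mul_raise]
    intro n; push_cast; ring
  rw [this, mul_sub, mul_smul_comm, mul_one, two_smul, two_mul]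

theorem weight_mul_lower (x : Fin D → Bool) :
    weight x * lower x = lower x * weight x + 2 * lower x := by
  have : weight x * lower x = lower x * (weight x + (2 : ℂ) • 1) := by
    have e : weight x + (2 : ℂ) • 1 = radial x fun k => (D : ℂ) - 2 * k + 2 :=
      LinearMap.ext fun f => funext fun y => by
        simp only [LinearMap.add_apply, Pi.add_apply, LinearMap.smul_apply, Pi.smul_apply, weight,
          radial_apply, Module.End.one_apply, smul_eq_mul]
        ring
    rw [e, weight, radial_mul_lower]
    intro n; push_cast; ring
  rw [this, mul_add, mul_smul_comm, mul_one, two_smul, two_mul]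

theorem toLin'_twistedDual (x : Fin D → Bool) :
    Matrix.toLin' (twistedDual D x) = parity x * weight x := by
  refine LinearMap.ext fun f => funext fun y => ?_
  rw [twistedDual, toLin'_diagonal_apply, Module.End.mul_apply, parity, weight, radial_apply,
    radial_apply, mul_assoc]

/-- The third member of the Leonard triple, as an operator on the standard module. -/
noncomputable def twistedAdj (x : Fin D → Bool) : Module.End ℂ ((Fin D → Bool) → ℂ) :=
  raise x * parity x + parity x * lower x

section

variable {R : Type*} [Ring R] {r l s h : R}

/-- The anticommutator relations from an `sl₂`-triple and an involution. -/
theorem spinRelations_of_sl2 (hlr : l * r = r * l + h) (hr : h * r = r * h - 2 * r)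
    (hl : h * l = l * h + 2 * l) (sr : s * r = -(r * s)) (sl : s * l = -(l * s))
    (ss : s * s = 1) (hs : h * s = s * h) :
    SpinRelations (l + r) (s * h) (r * s + s * l) := by
  have sr' : ∀ a, s * (r * a) = -(r * (s * a)) := fun a => by
    rw [← mul_assoc, sr, neg_mul, mul_assoc]
  have sl' : ∀ a, s * (l * a) = -(l * (s * a)) := fun a => by
    rw [← mul_assoc, sl, neg_mul, mul_assoc]
  have ss' : ∀ a, s * (s * a) = a := fun a => by rw [← mul_assoc, ss, one_mul]
  have hs' : ∀ a, h * (s * a) = s * (h * a) := fun a => by rw [← mul_assoc, hs, mul_assoc]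
  have hlr' : ∀ a, l * (r * a) = r * (l * a) + h * a := fun a => by
    rw [← mul_assoc, hlr, add_mul, mul_assoc]
  have hr' : ∀ a, h * (r * a) = r * (h * a) - 2 * (r * a) := fun a => by
    rw [← mul_assoc, hr, sub_mul, mul_assoc, mul_assoc]
  have hl' : ∀ a, h * (l * a) = l * (h * a) + 2 * (l * a) := fun a => by
    rw [← mul_assoc, hl, add_mul, mul_assoc, mul_assoc]
  -- The rules bring every word to the order r, l, s, h; the primed forms act in front of a
  -- remaining factor. Only additive bookkeeping is left.
  constructor <;>
  · simp only [add_mul, mul_add, mul_assoc, sr, sl, ss, hs, sr', sl', ss', hlr', hr, hr',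
      hl, hl', two_mul, mul_sub, mul_neg, neg_mul, mul_one]
    abel

theorem casimir_of_sl2 (hlr : l * r = r * l + h)
    (sr : s * r = -(r * s)) (sl : s * l = -(l * s))
    (ss : s * s = 1) (hs : h * s = s * h) :
    (l + r) * (l + r) + s * h * (s * h) + (r * s + s * l) * (r * s + s * l) =
      h * h + 2 * h + 4 * (r * l) := by
  have sr' : ∀ a, s * (r * a) = -(r * (s * a)) := fun a => by
    rw [← mul_assoc, sr, neg_mul, mul_assoc]
  have sl' : ∀ a, s * (l * a) = -(l * (s * a)) := fun a => by
    rw [← mul_assoc, sl, neg_mul, mul_assoc]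
  have ss' : ∀ a, s * (s * a) = a := fun a => by rw [← mul_assoc, ss, one_mul]
  have hs' : ∀ a, h * (s * a) = s * (h * a) := fun a => by rw [← mul_assoc, hs, mul_assoc]
  have e : (4 : R) = 1 + 1 + 1 + 1 := by norm_num
  simp only [add_mul, mul_add, mul_assoc, sl, ss, sr', sl', ss', hs', hlr, two_mul,
    mul_neg, neg_mul, e, one_mul, mul_one, neg_neg]
  abel

end

theorem spinRelations_cube (x : Fin D → Bool) :
    SpinRelations (Matrix.toLin' (cubeA D)) (Matrix.toLin' (twistedDual D x)) (twistedAdj x) := by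
  rw [toLin'_cubeA_eq x, toLin'_twistedDual]
  exact spinRelations_of_sl2 (lower_mul_raise x) (weight_mul_raise x) (weight_mul_lower x)
    (parity_mul_raise x) (parity_mul_lower x) (parity_mul_self x) (weight_mul_parity x)

theorem casimir_cube (x : Fin D → Bool) :
    Matrix.toLin' (cubeA D) * Matrix.toLin' (cubeA D) +
      Matrix.toLin' (twistedDual D x) * Matrix.toLin' (twistedDual D x) +
      twistedAdj x * twistedAdj x =
    weight x * weight x + 2 * weight x + 4 * (raise x * lower x) := by
  rw [toLin'_cubeA_eq x, toLin'_twistedDual]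
  exact casimir_of_sl2 (lower_mul_raise x) (parity_mul_raise x) (parity_mul_lower x)
    (parity_mul_self x) (weight_mul_parity x)

/-! ### Representations of the spin algebra and the matrix C -/

theorem map_two_freeAlgebra {A : Type*} [Ring A] [Algebra ℂ A]
    (f : FreeAlgebra ℂ SpinGen →ₐ[ℂ] A) : f 2 = 2 := by
  have : (2 : FreeAlgebra ℂ SpinGen) = 1 + 1 := one_add_one_eq_two.symm
  rw [this, map_add, map_one, one_add_one_eq_two]

/-- Representations of the anticommutator spin algebra from triples of operators. -/
noncomputable def SpinRelations.lift {A : Type*} [Ring A] [Algebra ℂ A] {X Y Z : A}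
    (h : SpinRelations X Y Z) : SpinAlgebra ℂ →ₐ[ℂ] A :=
  RingQuot.liftAlgHom ℂ ⟨FreeAlgebra.lift ℂ (SpinGen.rec X Y Z), by
    intro a b hab
    cases hab
    · simpa [map_two_freeAlgebra] using h.xy
    · simpa [map_two_freeAlgebra] using h.yz
    · simpa [map_two_freeAlgebra] using h.zx⟩

theorem SpinRelations.lift_gen {A : Type*} [Ring A] [Algebra ℂ A] {X Y Z : A}
    (h : SpinRelations X Y Z) (g : SpinGen) :
    h.lift (SpinAlgebra.gen ℂ g) = SpinGen.rec X Y Z g := by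
  rw [SpinRelations.lift, SpinAlgebra.gen, RingQuot.liftAlgHom_mkAlgHom_apply,
    FreeAlgebra.lift_ι_apply]

theorem spinRelations_gen : SpinRelations (SpinAlgebra.gen ℂ SpinGen.x)
    (SpinAlgebra.gen ℂ SpinGen.y) (SpinAlgebra.gen ℂ SpinGen.z) := by
  constructor
  · simpa [map_two_freeAlgebra, SpinAlgebra.gen] using RingQuot.mkAlgHom_rel ℂ (SpinRel.xy (K := ℂ))
  · simpa [map_two_freeAlgebra, SpinAlgebra.gen] using RingQuot.mkAlgHom_rel ℂ (SpinRel.yz (K := ℂ))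
  · simpa [map_two_freeAlgebra, SpinAlgebra.gen] using RingQuot.mkAlgHom_rel ℂ (SpinRel.zx (K := ℂ))

/-- The relation 2z = xy + yx determines the image of z, since 2 is invertible. -/
theorem spinAlgHom_ext {A : Type*} [Ring A] [Algebra ℂ A] {f g : SpinAlgebra ℂ →ₐ[ℂ] A}
    (hx : f (SpinAlgebra.gen ℂ SpinGen.x) = g (SpinAlgebra.gen ℂ SpinGen.x))
    (hy : f (SpinAlgebra.gen ℂ SpinGen.y) = g (SpinAlgebra.gen ℂ SpinGen.y)) : f = g := by
  have hz : f (SpinAlgebra.gen ℂ SpinGen.z) = g (SpinAlgebra.gen ℂ SpinGen.z) := by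
    have h1 := congrArg f spinRelations_gen.xy
    have h2 := congrArg g spinRelations_gen.xy
    simp only [map_add, map_mul, hx, hy, map_ofNat] at h1 h2
    have h3 := h1.symm.trans h2
    have e : ∀ a : A, 2 * a = (2 : ℂ) • a := fun a => by rw [two_mul, two_smul]
    rw [e, e] at h3
    exact smul_right_injective A (two_ne_zero (α := ℂ)) h3
  refine RingQuot.ringQuot_ext' ℂ _ _ (FreeAlgebra.hom_ext (funext fun s => ?_))
  cases s
  · exact hx
  · exact hy
  · exact hz

theorem isPositiveStructure_lift (x : Fin D → Bool) :
    IsPositiveStructure D x (spinRelations_cube x).lift := by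
  refine ⟨?_, ?_⟩
  · rw [SpinRelations.lift_gen]
  · rw [SpinRelations.lift_gen, cubeDual_eq]

theorem existsUnique_isPositiveStructure (D : ℕ) (x : Fin D → Bool) :
    ∃! ρ : SpinAlgebra ℂ →ₐ[ℂ] Module.End ℂ ((Fin D → Bool) → ℂ), IsPositiveStructure D x ρ :=
  ⟨_, isPositiveStructure_lift x, fun _ h => spinAlgHom_ext
    (h.1.trans (isPositiveStructure_lift x).1.symm) (h.2.trans (isPositiveStructure_lift x).2.symm)⟩

theorem toLin'_cubeC (x : Fin D → Bool) : Matrix.toLin' (cubeC D x) = twistedAdj x := by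
  have h : ∃ ρ, IsPositiveStructure D x ρ := ⟨_, isPositiveStructure_lift x⟩
  rw [cubeC, dif_pos h, (existsUnique_isPositiveStructure D x).unique h.choose_spec
    (isPositiveStructure_lift x), SpinRelations.lift_gen, Matrix.toLin'_toMatrix']

/-! ### Modules for the Terwilliger algebra and their levels -/

/-- The projection onto the functions supported at distance `i` from `x`. -/
noncomputable def levelProj (x : Fin D → Bool) (i : ℕ) : Module.End ℂ ((Fin D → Bool) → ℂ) :=
  radial x fun n => if n = i then 1 else 0

theorem dualIdempotent_mulVec (x : Fin D → Bool) (i : ℕ) (w : (Fin D → Bool) → ℂ) :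
    (dualIdempotent (hypercube D) x i).mulVec w = levelProj x i w := by
  funext y
  rw [← Matrix.toLin'_apply, dualIdempotent, toLin'_diagonal_apply, hypercube_dist]
  rfl

theorem isTModule_iff (x : Fin D → Bool) (W : Submodule ℂ ((Fin D → Bool) → ℂ)) :
    IsTModule (hypercube D) x W ↔ (∀ w ∈ W, Matrix.toLin' (cubeA D) w ∈ W) ∧
      ∀ i, ∀ w ∈ W, levelProj x i w ∈ W := by
  constructor
  · intro h
    refine ⟨fun w hw => ?_, fun i w hw => ?_⟩
    · rw [Matrix.toLin'_apply]
      exact h _ (le_sup_left (b := dualBoseMesner (hypercube D) x)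
        (Algebra.subset_adjoin (Set.mem_singleton _))) w hw
    · rw [← dualIdempotent_mulVec]
      exact h _ (le_sup_right (a := boseMesner (hypercube D))
        (Algebra.subset_adjoin (Set.mem_range_self i))) w hw
  · rintro ⟨hA, hE⟩ N hN
    rw [terwilligerAlgebra, boseMesner, dualBoseMesner, ← Algebra.adjoin_union] at hN
    induction hN using Algebra.adjoin_induction with
    | mem N hN =>
      intro w hw
      rcases hN with hN | ⟨i, rfl⟩
      · rw [Set.mem_singleton_iff] at hN
        subst hN
        exact hA w hw
      · rw [dualIdempotent_mulVec]
        exact hE i w hw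
    | algebraMap a =>
      intro w hw
      rw [Algebra.algebraMap_eq_smul_one, Matrix.smul_mulVec, Matrix.one_mulVec]
      exact W.smul_mem a hw
    | add M N _ _ hM hN =>
      intro w hw
      rw [Matrix.add_mulVec]
      exact W.add_mem (hM w hw) (hN w hw)
    | mul M N _ _ hM hN =>
      intro w hw
      rw [← Matrix.mulVec_mulVec]
      exact hM _ (hN w hw)

theorem radial_eq_sum_levelProj (x : Fin D → Bool) (c : ℕ → ℂ) :
    radial x c = ∑ i ∈ Finset.range (D + 1), c i • levelProj x i := by
  refine LinearMap.ext fun f => funext fun y => ?_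
  have hy : hammingDist x y ∈ Finset.range (D + 1) := by
    have := hammingDist_le_card_fintype (x := x) (y := y)
    rw [Fintype.card_fin] at this
    exact Finset.mem_range.2 (by omega)
  simp only [LinearMap.sum_apply, Finset.sum_apply, LinearMap.smul_apply, Pi.smul_apply,
    levelProj, radial_apply, smul_eq_mul, ite_mul, one_mul, zero_mul, mul_ite, mul_zero]
  rw [Finset.sum_ite_eq, if_pos hy]

theorem IsTModule.radial_mem {x : Fin D → Bool} {W : Submodule ℂ ((Fin D → Bool) → ℂ)}
    (h : IsTModule (hypercube D) x W) (c : ℕ → ℂ) {w : (Fin D → Bool) → ℂ} (hw : w ∈ W) :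
    radial x c w ∈ W := by
  rw [radial_eq_sum_levelProj, LinearMap.sum_apply]
  exact W.sum_mem fun i _ => W.smul_mem _ (((isTModule_iff x W).1 h).2 i w hw)

theorem radial_apply_of_level {x : Fin D → Bool} {i : ℕ} {v : (Fin D → Bool) → ℂ}
    (hv : levelProj x i v = v) (c : ℕ → ℂ) : radial x c v = c i • v := by
  rw [← hv, ← Module.End.mul_apply, levelProj, radial_mul_radial, ← LinearMap.smul_apply,
    radial_smul]
  congr 1
  congr 1
  funext n
  split_ifs with h
  · rw [h]
  · simp

theorem levelProj_apply_of_ne {x : Fin D → Bool} {i j : ℕ} (hij : j ≠ i)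
    {v : (Fin D → Bool) → ℂ} (hv : levelProj x i v = v) : levelProj x j v = 0 := by
  rw [levelProj, radial_apply_of_level hv, if_neg hij.symm, zero_smul]

theorem eq_zero_of_levelProj {x : Fin D → Bool} {v : (Fin D → Bool) → ℂ}
    (hv : ∀ i, levelProj x i v = 0) : v = 0 := by
  funext y
  have := congrFun (hv (hammingDist x y)) y
  rwa [levelProj, radial_apply, if_pos rfl, one_mul] at this

theorem levelProj_eq_zero (x : Fin D → Bool) {i : ℕ} (hi : D < i) : levelProj x i = 0 := by
  refine LinearMap.ext fun f => funext fun y => ?_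
  have := hammingDist_le_card_fintype (x := x) (y := y)
  rw [Fintype.card_fin] at this
  rw [levelProj, radial_apply, if_neg (by omega), zero_mul]
  rfl

theorem levelProj_lower (x : Fin D → Bool) (i : ℕ) (v : (Fin D → Bool) → ℂ) :
    levelProj x i (lower x v) = lower x (levelProj x (i + 1) v) := by
  rw [← Module.End.mul_apply, ← Module.End.mul_apply, levelProj, levelProj, radial_mul_lower]
  intro n
  simp

theorem levelProj_succ_raise (x : Fin D → Bool) (i : ℕ) (v : (Fin D → Bool) → ℂ) :
    levelProj x (i + 1) (raise x v) = raise x (levelProj x i v) := by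
  rw [← Module.End.mul_apply, ← Module.End.mul_apply, levelProj, levelProj, radial_mul_raise]
  intro n
  simp

/-- For v at level i, the part of Av at level i + 1 is exactly the raised vector, so it is obtained
from v by operators in T. -/
theorem IsTModule.raise_mem {x : Fin D → Bool} {W : Submodule ℂ ((Fin D → Bool) → ℂ)}
    (h : IsTModule (hypercube D) x W) {i : ℕ} {v : (Fin D → Bool) → ℂ} (hvW : v ∈ W)
    (hv : levelProj x i v = v) : raise x v ∈ W := by
  obtain ⟨hA, hE⟩ := (isTModule_iff x W).1 h
  have := hE (i + 1) _ (hA v hvW)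
  rwa [toLin'_cubeA_eq x, LinearMap.add_apply, map_add, levelProj_lower,
    levelProj_apply_of_ne (by omega) hv, map_zero, zero_add, levelProj_succ_raise, hv] at this

theorem IsTModule.lower_mem {x : Fin D → Bool} {W : Submodule ℂ ((Fin D → Bool) → ℂ)}
    (h : IsTModule (hypercube D) x W) {i : ℕ} {v : (Fin D → Bool) → ℂ} (hvW : v ∈ W)
    (hv : levelProj x i v = v) : lower x v ∈ W := by
  have := W.sub_mem (((isTModule_iff x W).1 h).1 v hvW) (h.raise_mem hvW hv)
  rwa [toLin'_cubeA_eq x, LinearMap.add_apply, add_sub_cancel_right] at this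

/-! ### The structure of irreducible modules -/

/-- A basis `v 0, …, v n` of a thin module for the Terwilliger algebra with endpoint `r`, on which
the raising and lowering operators act in the standard way. -/
structure IsStandardChain (x : Fin D → Bool) (W : Submodule ℂ ((Fin D → Bool) → ℂ)) (r n : ℕ)
    (v : ℕ → (Fin D → Bool) → ℂ) : Prop where
  eq : D = 2 * r + n
  level : ∀ i, levelProj x (r + i) (v i) = v i
  raise_apply : ∀ i, raise x (v i) = v (i + 1)
  top : v (n + 1) = 0
  lower_zero : lower x (v 0) = 0
  lower_succ : ∀ i, lower x (v (i + 1)) = (((i : ℂ) + 1) * (n - i)) • v i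
  linearIndependent : LinearIndependent ℂ fun i : Fin (n + 1) => v i
  span : Submodule.span ℂ (Set.range fun i : Fin (n + 1) => v i) = W

/-- The usual sl₂ induction: each commutation of L past R adds the weight D - 2(r + i) of the
current level. -/
theorem lower_raise_pow (x : Fin D → Bool) {r : ℕ} {v : (Fin D → Bool) → ℂ}
    (hv : lower x v = 0) (hlev : ∀ i, levelProj x (r + i) ((raise x ^ i) v) = (raise x ^ i) v)
    (i : ℕ) : lower x ((raise x ^ (i + 1)) v) =
      (((i : ℂ) + 1) * ((D : ℂ) - 2 * r - i)) • (raise x ^ i) v := by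
  have key : ∀ i, lower x ((raise x ^ (i + 1)) v) = raise x (lower x ((raise x ^ i) v)) +
      ((D : ℂ) - 2 * (r + i : ℕ)) • (raise x ^ i) v := by
    intro i
    rw [pow_succ', Module.End.mul_apply, ← Module.End.mul_apply, lower_mul_raise,
      LinearMap.add_apply, Module.End.mul_apply, weight, radial_apply_of_level (hlev i)]
  induction i with
  | zero => rw [key]; simp [hv]
  | succ i ih =>
    rw [key, ih, map_smul, ← Module.End.mul_apply, ← pow_succ', ← add_smul]
    congr 1
    push_cast
    ring

theorem exists_isStandardChain {x : Fin D → Bool} {W : Submodule ℂ ((Fin D → Bool) → ℂ)} {r : ℕ}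
    (hW : IsIrreducibleTModule (hypercube D) x W) (hr : IsEndpoint (hypercube D) x W r) :
    ∃ n v, IsStandardChain x W r n v := by
  obtain ⟨hT, -, hirr⟩ := hW
  obtain ⟨⟨w, hwW, hw⟩, hmin⟩ := hr
  rw [dualIdempotent_mulVec] at hw
  have hmin' : ∀ i < r, ∀ w ∈ W, levelProj x i w = 0 := by
    intro i hi w hw
    by_contra hne
    exact absurd (hmin ⟨w, hw, by rwa [dualIdempotent_mulVec]⟩) (by omega)
  set v₀ := levelProj x r w with hv₀
  have hv₀W : v₀ ∈ W := ((isTModule_iff x W).1 hT).2 r w hwW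
  have hlev₀ : levelProj x r v₀ = v₀ := by
    rw [hv₀, ← Module.End.mul_apply, levelProj, radial_mul_radial]
    congr 2
    funext n
    split_ifs <;> simp
  -- The lowered vector lies in W at level r - 1, where W vanishes by minimality of r.
  have hlow : lower x v₀ = 0 := by
    refine eq_zero_of_levelProj (x := x) fun i => ?_
    by_cases hi : i + 1 = r
    · exact hmin' i (by omega) _ (hT.lower_mem hv₀W hlev₀)
    · rw [levelProj_lower, levelProj_apply_of_ne hi hlev₀, map_zero]
  set v : ℕ → (Fin D → Bool) → ℂ := fun i => (raise x ^ i) v₀ with hv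
  have hraise : ∀ i, raise x (v i) = v (i + 1) := fun i => by
    simp only [hv, pow_succ', Module.End.mul_apply]
  have hlev : ∀ i, levelProj x (r + i) (v i) = v i := by
    intro i
    induction i with
    | zero => simpa [hv] using hlev₀
    | succ i ih => rw [← hraise, ← add_assoc, levelProj_succ_raise, ih]
  have hvW : ∀ i, v i ∈ W := by
    intro i
    induction i with
    | zero => simpa [hv] using hv₀W
    | succ i ih => rw [← hraise]; exact hT.raise_mem ih (hlev i)
  have hlower := lower_raise_pow x hlow hlev
  -- The vector v (D + 1) would live at level r + D + 1, beyond the diameter.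
  have hex : ∃ n, v (n + 1) = 0 := ⟨D, by
    rw [← hlev, levelProj_eq_zero x (by omega)]; rfl⟩
  classical
  set n := Nat.find hex with hn
  have htop : v (n + 1) = 0 := Nat.find_spec hex
  have hne : ∀ i ≤ n, v i ≠ 0 := by
    intro i hi
    rcases i with _ | i
    · simpa [hv] using hw
    · exact Nat.find_min hex (by omega)
  -- Lowering v (n + 1) = 0 gives (n + 1)(D - 2r - n) v n = 0 with v n nonzero, which pins down the
  -- length of the chain.
  have hD : (D : ℂ) - 2 * r - n = 0 := by
    have h1 := hlower n
    change lower x (v (n + 1)) = _ • v n at h1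
    rw [htop, map_zero] at h1
    have h2 := (smul_eq_zero.1 h1.symm).resolve_right (hne n le_rfl)
    exact (mul_eq_zero.1 h2).resolve_left (Nat.cast_add_one_ne_zero n)
  have hDn : D = 2 * r + n := by
    have : (D : ℂ) = (2 * r + n : ℕ) := by push_cast; linear_combination hD
    exact_mod_cast this
  have hdiag : ∀ c i, radial x c (v i) = c (r + i) • v i := fun c i =>
    radial_apply_of_level (hlev i) c
  have hli : LinearIndependent ℂ fun i : Fin (n + 1) => v i := by
    refine Module.End.eigenvectors_linearIndependent' (radial x fun k => (k : ℂ))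
      (fun i : Fin (n + 1) => ((r + i : ℕ) : ℂ)) ?_ _ ?_
    · intro i j hij
      have := Nat.cast_injective hij
      exact Fin.ext (by omega)
    · intro i
      exact ⟨Module.End.mem_eigenspace_iff.2 (hdiag _ _), hne i (by omega)⟩
  refine ⟨n, v, hDn, hlev, hraise, htop, by simpa [hv] using hlow, fun i => ?_, hli, ?_⟩
  · refine (hlower i).trans ?_
    congr 2
    linear_combination hD
  · set U := Submodule.span ℂ (Set.range fun i : Fin (n + 1) => v i) with hU
    have hmem : ∀ i ≤ n, v i ∈ U := fun i hi =>
      Submodule.subset_span ⟨⟨i, by omega⟩, rfl⟩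
    have hle : U ≤ W := Submodule.span_le.2 (by rintro _ ⟨i, rfl⟩; exact hvW i)
    have hmem' : ∀ i ≤ n + 1, v i ∈ U := by
      intro i hi
      rcases hi.lt_or_eq with hi | rfl
      · exact hmem i (by omega)
      · rw [htop]; exact U.zero_mem
    have hinv : ∀ F : Module.End ℂ ((Fin D → Bool) → ℂ), (∀ i ≤ n, F (v i) ∈ U) →
        ∀ u ∈ U, F u ∈ U := by
      intro F hF
      have : U ≤ U.comap F := Submodule.span_le.2 (by
        rintro _ ⟨i, rfl⟩
        exact hF i (by omega))
      exact fun u hu => this hu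
    have hTU : IsTModule (hypercube D) x U := by
      rw [isTModule_iff]
      refine ⟨hinv _ fun i hi => ?_, fun j => hinv _ fun i hi => ?_⟩
      · rw [toLin'_cubeA_eq x, LinearMap.add_apply, hraise]
        refine U.add_mem ?_ (hmem' _ (by omega))
        rcases i with _ | i
        · have : v 0 = v₀ := by simp [hv]
          rw [this, hlow]; exact U.zero_mem
        · refine (hlower i).symm ▸ U.smul_mem _ (hmem i (by omega))
      · rw [levelProj, hdiag]
        exact U.smul_mem _ (hmem i hi)
    rcases hirr U hTU hle with h | h
    · exact absurd ((Submodule.mem_bot ℂ).1 (h ▸ hmem 0 (by omega))) (hne 0 (by omega))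
    · exact h

namespace IsStandardChain

variable {x : Fin D → Bool} {W : Submodule ℂ ((Fin D → Bool) → ℂ)} {r n : ℕ}
  {v : ℕ → (Fin D → Bool) → ℂ}

theorem mem (h : IsStandardChain x W r n v) {i : ℕ} (hi : i ≤ n) : v i ∈ W := by
  rw [← h.span]
  exact Submodule.subset_span ⟨⟨i, by omega⟩, rfl⟩

theorem ne_zero (h : IsStandardChain x W r n v) {i : ℕ} (hi : i ≤ n) : v i ≠ 0 :=
  h.linearIndependent.ne_zero (⟨i, by omega⟩ : Fin (n + 1))

theorem finrank (h : IsStandardChain x W r n v) : Module.finrank ℂ W = n + 1 := by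
  rw [← h.span, finrank_span_eq_card h.linearIndependent, Fintype.card_fin]

theorem casimir (h : IsStandardChain x W r n v) {w : (Fin D → Bool) → ℂ} (hw : w ∈ W) :
    (weight x * weight x + 2 * weight x + 4 * (raise x * lower x)) w =
      ((n : ℂ) * (n + 2)) • w := by
  have hD : (D : ℂ) = 2 * r + n := by exact_mod_cast h.eq
  have e2 : (2 : Module.End ℂ ((Fin D → Bool) → ℂ)) = (2 : ℂ) • 1 := by rw [two_smul]; norm_num
  have e4 : (4 : Module.End ℂ ((Fin D → Bool) → ℂ)) = (4 : ℂ) • 1 := by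
    rw [show (4 : ℂ) = 2 + 2 by norm_num, add_smul, ← e2]; norm_num
  have hweight : ∀ i, weight x (v i) = ((n : ℂ) - 2 * i) • v i := fun i => by
    rw [weight, radial_apply_of_level (h.level i), hD]
    congr 1; push_cast; ring
  have hrl : ∀ i, raise x (lower x (v i)) = ((i : ℂ) * (n - i + 1)) • v i := by
    intro i
    rcases i with _ | i
    · rw [h.lower_zero]; simp
    · rw [h.lower_succ, map_smul, h.raise_apply]
      congr 1; push_cast; ring
  rw [← h.span] at hw
  induction hw using Submodule.span_induction with
  | mem w hw =>
    obtain ⟨i, rfl⟩ := hw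
    simp only [e2, e4, smul_mul_assoc, one_mul, LinearMap.add_apply, LinearMap.smul_apply,
      Module.End.mul_apply, hweight, hrl, map_smul, smul_smul, ← add_smul]
    congr 1; ring
  | zero => simp
  | add u w _ _ hu hw => rw [map_add, hu, hw, smul_add]
  | smul a w _ hw => rw [map_smul, hw, smul_comm]

/-- An operator that acts on a standard chain like the adjacency matrix, up to signs, has the
eigenvalue `n`. -/
theorem exists_eigenvector (h : IsStandardChain x W r n v)
    {F : Module.End ℂ ((Fin D → Bool) → ℂ)} {a : ℕ → ℂ} (ha : ∀ i, a i * a i = 1)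
    (hzero : F (v 0) = a 0 • v 1)
    (hsucc : ∀ i, F (v (i + 1)) = a (i + 1) • v (i + 2) +
      (a i * (((i : ℂ) + 1) * (n - i))) • v i) :
    ∃ u ∈ W, u ≠ 0 ∧ F u = (n : ℂ) • u := by
  -- For a = 1 this is the truncated exponential, the sum of R^i v₀ / i!. The product of signs
  -- absorbs the twist.
  set q : ℕ → ℂ := fun i => (∏ l ∈ Finset.range i, a l) / (i.factorial : ℂ) with hq
  have hq0 : q 0 = 1 := by simp [hq]
  have hqs : ∀ i : ℕ, ((i : ℂ) + 1) * q (i + 1) = a i * q i := by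
    intro i
    have h1 : (i : ℂ) + 1 ≠ 0 := Nat.cast_add_one_ne_zero i
    have h2 : (i.factorial : ℂ) ≠ 0 := Nat.cast_ne_zero.2 i.factorial_ne_zero
    simp only [hq, Finset.prod_range_succ, Nat.factorial_succ]
    push_cast
    field_simp
  clear_value q
  -- A partial sum is an eigenvector up to terms at its upper end. At m = n the coefficient m
  -- becomes n and v (n + 1) = 0 removes the rest.
  have key : ∀ m : ℕ, F (∑ i ∈ Finset.range (m + 1), q i • v i) =
      (n : ℂ) • ∑ i ∈ Finset.range m, q i • v i + ((m : ℂ) * q m) • v m +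
        (a m * q m) • v (m + 1) := by
    intro m
    induction m with
    | zero => simp [hq0, hzero]
    | succ m ih =>
      rw [Finset.sum_range_succ, map_add, ih, map_smul, hsucc, Finset.sum_range_succ _ m]
      match_scalars
      · ring
      · linear_combination ((n : ℂ) - m) * a m * hqs m + ((n : ℂ) - m) * q m * ha m
      · linear_combination -hqs m
      · ring
  refine ⟨∑ i ∈ Finset.range (n + 1), q i • v i,
    W.sum_mem fun i hi => W.smul_mem _ (h.mem (by simpa [Nat.lt_succ_iff] using hi)), ?_, ?_⟩
  · intro h0
    rw [← Fin.sum_univ_eq_sum_range (fun i => q i • v i)] at h0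
    have := Fintype.linearIndependent_iff.1 h.linearIndependent (fun i => q i) h0 0
    simp [hq0] at this
  · rw [key, h.top, Finset.sum_range_succ, smul_zero, add_zero, smul_add, smul_smul]

theorem exists_eigenvector_cubeA (h : IsStandardChain x W r n v) :
    ∃ u ∈ W, u ≠ 0 ∧ Matrix.toLin' (cubeA D) u = (n : ℂ) • u := by
  refine h.exists_eigenvector (a := fun _ => 1) (fun _ => by norm_num) ?_ fun i => ?_
  · rw [toLin'_cubeA_eq x, LinearMap.add_apply, h.lower_zero, h.raise_apply, zero_add, one_smul]
  · rw [toLin'_cubeA_eq x, LinearMap.add_apply, h.lower_succ, h.raise_apply, one_smul, one_mul, add_comm]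

theorem exists_eigenvector_twistedAdj (h : IsStandardChain x W r n v) :
    ∃ u ∈ W, u ≠ 0 ∧ twistedAdj x u = (n : ℂ) • u := by
  have hpar : ∀ i, parity x (v i) = ((-1 : ℂ) ^ (r + i)) • v i := fun i =>
    radial_apply_of_level (h.level i) _
  refine h.exists_eigenvector (a := fun i => (-1) ^ (r + i))
    (fun _ => neg_one_pow_mul_self_complex _) ?_ fun i => ?_
  · simp only [twistedAdj, LinearMap.add_apply, Module.End.mul_apply, h.lower_zero, hpar,
      map_smul, h.raise_apply, map_zero, add_zero]
  · simp only [twistedAdj, LinearMap.add_apply, Module.End.mul_apply, h.lower_succ, hpar,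
      map_smul, h.raise_apply, smul_smul]
    rw [mul_comm]

/-- This operator is diagonal on the chain, with values (-1)^(r+i) (n - 2i): the value n occurs at i
= 0 if r is even and at i = n if r is odd. -/
theorem exists_eigenvector_twistedDual (h : IsStandardChain x W r n v) (hn : Even n) :
    ∃ u ∈ W, u ≠ 0 ∧ Matrix.toLin' (twistedDual D x) u = (n : ℂ) • u := by
  have hD : (D : ℂ) = 2 * r + n := by exact_mod_cast h.eq
  have hB : ∀ i, Matrix.toLin' (twistedDual D x) (v i) =
      ((-1 : ℂ) ^ (r + i) * (n - 2 * i)) • v i := fun i => by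
    rw [toLin'_twistedDual, parity, weight, radial_mul_radial, radial_apply_of_level (h.level i),
      hD]
    congr 2; push_cast; ring
  rcases Nat.even_or_odd r with hr | hr
  · refine ⟨v 0, h.mem (by omega), h.ne_zero (by omega), ?_⟩
    rw [hB]
    simp [hr.neg_one_pow]
  · refine ⟨v n, h.mem le_rfl, h.ne_zero le_rfl, ?_⟩
    rw [hB, (hr.add_even hn).neg_one_pow]
    congr 1; ring

end IsStandardChain

/-! ### Restriction to W and conclusion -/

theorem SpinRelations.restrict {V : Type*} [AddCommGroup V] [Module ℂ V] {A B C : Module.End ℂ V}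
    (h : SpinRelations A B C) {W : Submodule ℂ V} (hA : ∀ w ∈ W, A w ∈ W)
    (hB : ∀ w ∈ W, B w ∈ W) (hC : ∀ w ∈ W, C w ∈ W) :
    SpinRelations (A.restrict hA) (B.restrict hB) (C.restrict hC) := by
  obtain ⟨h1, h2, h3⟩ := h
  rw [two_mul] at h1 h2 h3
  constructor <;> rw [two_mul] <;> refine LinearMap.ext fun w => Subtype.ext ?_
  · exact LinearMap.congr_fun h1 w
  · exact LinearMap.congr_fun h2 w
  · exact LinearMap.congr_fun h3 w

theorem isSpinModule_restrict {V : Type*} [AddCommGroup V] [Module ℂ V] {A B C : Module.End ℂ V}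
    (h : SpinRelations A B C) {W : Submodule ℂ V} (hA : ∀ w ∈ W, A w ∈ W)
    (hB : ∀ w ∈ W, B w ∈ W) (hC : ∀ w ∈ W, C w ∈ W) {n : ℕ} (hn : Even n)
    (hfin : Module.finrank ℂ W = n + 1)
    (hcas : ∀ w ∈ W, (A * A + B * B + C * C) w = ((n : ℂ) * (n + 2)) • w)
    (heig : ∃ u ∈ W, u ≠ 0 ∧ A u = (n : ℂ) • u) :
    IsSpinModule n (A.restrict hA) (B.restrict hB) (C.restrict hC) where
  rel := h.restrict hA hB hC
  even := hn
  finrank := hfin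
  casimir := LinearMap.ext fun w => Subtype.ext (hcas w w.2)
  eigen := by
    obtain ⟨u, hu, hu0, hA⟩ := heig
    exact ⟨⟨u, hu⟩, fun e => hu0 (congrArg Subtype.val e), Subtype.ext hA⟩

end Cube

theorem theoremT (D : ℕ) (hD : Even D) (x : Fin D → Bool)
    (W : Submodule ℂ ((Fin D → Bool) → ℂ)) (r : ℕ)
    (hW : IsIrreducibleTModule (hypercube D) x W)
    (hr : IsEndpoint (hypercube D) x W r) :
    (∃! ρ : SpinAlgebra ℂ →ₐ[ℂ] Module.End ℂ ((Fin D → Bool) → ℂ), IsPositiveStructure D x ρ) ∧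
    ∃ (hA : ∀ w ∈ W, Matrix.toLin' (cubeA D) w ∈ W)
      (hB : ∀ w ∈ W, Matrix.toLin' (cubeB D x) w ∈ W)
      (hC : ∀ w ∈ W, Matrix.toLin' (cubeC D x) w ∈ W),
      IsTotallyBipartite ((Matrix.toLin' (cubeA D)).restrict hA)
        ((Matrix.toLin' (cubeB D x)).restrict hB) ((Matrix.toLin' (cubeC D x)).restrict hC) ∧
      IsNormalizedLeonardTriple ((Matrix.toLin' (cubeA D)).restrict hA)
        ((Matrix.toLin' (cubeB D x)).restrict hB) ((Matrix.toLin' (cubeC D x)).restrict hC) ∧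
      leonardDiameter ℂ W = (D : ℤ) - 2 * (r : ℤ) := by
  refine ⟨existsUnique_isPositiveStructure D x, ?_⟩
  obtain ⟨n, v, h⟩ := exists_isStandardChain hW hr
  have hn : Even n := by
    have := h.eq
    rw [this] at hD
    exact (Nat.even_add.1 hD).1 (even_two_mul r)
  have hA := ((isTModule_iff x W).1 hW.1).1
  have hrel : SpinRelations (Matrix.toLin' (cubeA D)) (Matrix.toLin' (cubeB D x))
      (Matrix.toLin' (cubeC D x)) := by
    rw [cubeB_eq hD, toLin'_cubeC]; exact spinRelations_cube x
  have hB : ∀ w ∈ W, Matrix.toLin' (cubeB D x) w ∈ W := by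
    intro w hw
    rw [cubeB_eq hD, toLin'_twistedDual]
    exact hW.1.radial_mem _ (hW.1.radial_mem _ hw)
  have hC : ∀ w ∈ W, Matrix.toLin' (cubeC D x) w ∈ W := by
    intro w hw
    -- Invariance under C follows from that under A and B, because 2C = AB + BA.
    have h1 := LinearMap.congr_fun hrel.xy w
    rw [two_mul, ← two_smul ℂ, LinearMap.smul_apply] at h1
    have h2 : (2 : ℂ) • Matrix.toLin' (cubeC D x) w ∈ W := by
      rw [← h1]
      exact W.add_mem (hA _ (hB w hw)) (hB _ (hA w hw))
    exact (W.smul_mem_iff two_ne_zero).1 h2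
  have hcas : ∀ w ∈ W, (Matrix.toLin' (cubeA D) * Matrix.toLin' (cubeA D) +
      Matrix.toLin' (cubeB D x) * Matrix.toLin' (cubeB D x) +
      Matrix.toLin' (cubeC D x) * Matrix.toLin' (cubeC D x)) w = ((n : ℂ) * (n + 2)) • w := by
    intro w hw
    rw [cubeB_eq hD, toLin'_cubeC, casimir_cube, h.casimir hw]
  have s1 := isSpinModule_restrict hrel hA hB hC hn h.finrank hcas h.exists_eigenvector_cubeA
  have s2 := isSpinModule_restrict hrel.rotate hB hC hA hn h.finrank
    (fun w hw => by rw [← hcas w hw, ← add_rotate])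
    (by rw [cubeB_eq hD]; exact h.exists_eigenvector_twistedDual hn)
  have s3 := isSpinModule_restrict hrel.rotate.rotate hC hA hB hn h.finrank
    (fun w hw => by rw [← hcas w hw, add_rotate])
    (by rw [toLin'_cubeC]; exact h.exists_eigenvector_twistedAdj)
  refine ⟨hA, hB, hC, s1.isTotallyBipartite s2 s3, s1.isNormalizedLeonardTriple s2 s3, ?_⟩
  have := h.eq
  rw [leonardDiameter, h.finrank]
  omega
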